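/- Let $V=\mathbb{C}[x_1,x_2,\dots]$ be the free bosonic vertex algebra: its vacuum vector is $1$, and its products $a_{(n)}b$ ($n\in\mathbb{Z}$), written $Y(a,z)=\sum_{n\in\mathbb{Z}}a_{(n)}z^{-n-1}$, are linear in $a$ and given on monomials by $$Y(x_{i_1}\cdots x_{i_k},z)={:}\,\partial^{(i_1-1)}\alpha(z)\cdots\partial^{(i_k-1)}\alpha(z)\,{:}\,,\qquad \alpha(z)=\sum_{n\in\mathbb{Z}}\alpha_n z^{-n-1},$$ where $\alpha_n=n\,\partial/\partial x_n$ for $n>0$, $\alpha_0=0$, $\alpha_n$ is multiplication by $x_{-n}$ for $n<0$, $\partial^{(j)}=\frac{1}{j!}\partial_z^j$, and ${:}A(z)B(z){:}=A(z)_-B(z)+B(z)A(z)_+$ is the normally ordered product (nested from the right; $A(z)_-$ and $A(z)_+$ are the parts of $A(z)=\sum_n A_{(n)}z^{-n-1}$ with $n<0$ and $n\ge 0$). The empty product is the identity field. Put $Ta=a_{(-2)}1$. A conformal vector of $V$ is a non-zero vector $v\in V$ such that, for some $c\in\mathbb{C}$, $v_{(n)}v=0$ for $n\ge 4$, $v_{(3)}v=\frac{c}{2}1$,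 $v_{(2)}v=0$, $v_{(1)}v=2v$, $v_{(0)}v=Tv$, and such that moreover $v_{(1)}$ is a semisimple operator on $V$ and $v_{(0)}=T$. An automorphism of $V$ is a linear bijection $\sigma:V\to V$ with $\sigma(a_{(n)}b)=\sigma(a)_{(n)}\sigma(b)$ for all $a,b\in V$, $n\in\mathbb{Z}$. Let $v$ be a conformal vector of $V$ and put $L_n=v_{(n+1)}$. Then, with $\{E,H,F\}$ the standard basis of $sl_2(\mathbb{C})$, $$E\mapsto -L_1,\qquad H\mapsto -2L_0,\qquad F\mapsto L_{-1}$$ defines an $sl_2(\mathbb{C})$-module structure on $V$, and this module is completely reducible (every submodule has a complementary submodule) if and only if there is an automorphism $\sigma\neq\mathrm{id}$ of $V$ with $\sigma(v)=v$. -/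

import Mathlib

attribute [local instance] LieRing.ofAssociativeRing

namespace FreeBoson

noncomputable section

/-- A field `A(z) = ∑ₙ A₍ₙ₎ z⁻ⁿ⁻¹` on a complex vector space `M`: a formal series with
coefficients in `End M` such that `A₍ₙ₎ u = 0` for all sufficiently large `n`, for every `u`. -/
structure FormalField (M : Type*) [AddCommGroup M] [Module ℂ M] where
  /-- The Fourier mode `A₍ₙ₎`, the coefficient of `z⁻ⁿ⁻¹`. -/
  mode : ℤ → Module.End ℂ M
  exists_bound : ∀ u : M, ∃ N : ℤ, ∀ n : ℤ, N ≤ n → mode n u = 0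

namespace FormalField

variable {M : Type*} [AddCommGroup M] [Module ℂ M]

/-- The identity field `I(z) = id`, whose only non-zero mode is the one of index `-1`. -/
def one : FormalField M where
  mode n := if n = -1 then LinearMap.id else 0
  exists_bound u := ⟨0, fun n hn => by
    rw [if_neg (by omega)]; rfl⟩

/-- The divided derivative `∂⁽ʲ⁾A(z) = (1/j!) ∂ʲ A(z)`. Since
`∂⁽ʲ⁾ z⁻ᵐ⁻¹ = binom(-m-1, j) z⁻ᵐ⁻¹⁻ʲ`, the coefficient of `z⁻ⁿ⁻¹` comes from `m = n - j`. -/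
def dividedDeriv (j : ℕ) (A : FormalField M) : FormalField M where
  mode n := Ring.choose ((j : ℤ) - n - 1) j • A.mode (n - j)
  exists_bound u := by
    obtain ⟨N, hN⟩ := A.exists_bound u
    refine ⟨N + j, fun n hn => ?_⟩
    rw [LinearMap.smul_apply, hN _ (by omega), smul_zero]

section NormalOrder

variable (A B : FormalField M)

/-- The `j`-th summand of the `n`-th mode, applied to `u`, of the normally ordered product
`A(z)₋ B(z) + B(z) A(z)₊`, where `A(z)₋` consists of the modes of negative index and `A(z)₊` of
those of non-negative index. -/
def normalOrderTerm (n : ℤ) (j : ℕ) : Module.End ℂ M :=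
  A.mode (-(j : ℤ) - 1) * B.mode (n + j) + B.mode (n - j - 1) * A.mode j

theorem normalOrderTerm_finite (n : ℤ) (u : M) :
    (Function.support fun j : ℕ => normalOrderTerm A B n j u).Finite := by
  obtain ⟨N₁, h₁⟩ := A.exists_bound u
  obtain ⟨N₂, h₂⟩ := B.exists_bound u
  refine (Set.finite_lt_nat (max N₁ (N₂ - n)).toNat).subset fun j hj => ?_
  by_contra hlt
  simp only [Set.mem_ofPred_eq, not_lt] at hlt
  have hle := Int.toNat_le.mp hlt
  apply hj
  simp [normalOrderTerm, h₁ j (by omega), h₂ (n + j) (by omega)]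

/-- The normally ordered product `:A(z)B(z): = A(z)₋ B(z) + B(z) A(z)₊`. Applied to a vector, each
mode is a sum with only finitely many non-zero terms. -/
def normalOrder : FormalField M where
  mode n :=
    { toFun := fun u => ∑ᶠ j : ℕ, normalOrderTerm A B n j u
      map_add' := fun u w => by
        simp only [map_add]
        exact finsum_add_distrib (normalOrderTerm_finite A B n u) (normalOrderTerm_finite A B n w)
      map_smul' := fun c u => by
        simp only [map_smul, RingHom.id_apply]
        exact (smul_finsum' c (normalOrderTerm_finite A B n u)).symm }
  exists_bound u := by
    obtain ⟨N₁, h₁⟩ := A.exists_bound u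
    obtain ⟨N₂, h₂⟩ := B.exists_bound u
    choose N₃ h₃ using fun j : ℕ => B.exists_bound (A.mode j u)
    obtain ⟨K, hK⟩ := ((Finset.range N₁.toNat).image N₃).exists_le
    refine ⟨max N₂ (K + N₁.toNat + 1), fun n hn => ?_⟩
    refine (finsum_congr fun j => ?_).trans finsum_zero
    have e₂ : B.mode (n + j) u = 0 := h₂ _ (by omega)
    have e₁ : B.mode (n - j - 1) (A.mode j u) = 0 := by
      by_cases hj : j < N₁.toNat
      · have := hK (N₃ j) (Finset.mem_image_of_mem _ (Finset.mem_range.mpr hj))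
        exact h₃ j _ (by omega)
      · rw [h₁ j (by omega), map_zero]
    simp [normalOrderTerm, e₁, e₂]

end NormalOrder

end FormalField

/-- The Fock space `ℂ[x₁, x₂, …]` of charge `0`. -/
abbrev Fock : Type := MvPolynomial ℕ+ ℂ

/-- The Heisenberg operators on the Fock space of charge `0`: `αₙ = n ∂/∂xₙ` for `n > 0`, `α₀ = 0`,
and `αₙ` is multiplication by `x₋ₙ` for `n < 0`. -/
def alpha : ℤ → Module.End ℂ Fock
  | Int.ofNat 0 => 0
  | Int.ofNat (k + 1) => ((k : ℂ) + 1) • (MvPolynomial.pderiv k.succPNat).toLinearMap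
  | Int.negSucc k => LinearMap.mulLeft ℂ (MvPolynomial.X k.succPNat)

theorem alpha_bound (u : Fock) : ∃ N : ℤ, ∀ n : ℤ, N ≤ n → alpha n u = 0 := by
  obtain ⟨K, hK⟩ := (u.vars.image (fun i : ℕ+ => (i : ℕ))).exists_le
  refine ⟨K + 1, fun n hn => ?_⟩
  match n, hn with
  | Int.ofNat 0, _ => rfl
  | Int.ofNat (k + 1), hn =>
    have hv : k.succPNat ∉ u.vars := fun hmem => by
      have := hK _ (Finset.mem_image_of_mem _ hmem)
      simp only [Nat.succPNat_coe, Int.ofNat_eq_natCast] at this hn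
      omega
    have h0 : MvPolynomial.pderiv k.succPNat u = 0 :=
      MvPolynomial.pderiv_eq_zero_of_notMem_vars hv
    change ((k : ℂ) + 1) • MvPolynomial.pderiv k.succPNat u = 0
    rw [h0, smul_zero]
  | Int.negSucc k, hn =>
    exact absurd hn (by have := Int.negSucc_lt_zero k; omega)

/-- The Heisenberg field `α(z) = ∑ₙ αₙ z⁻ⁿ⁻¹`. -/
def alphaField : FormalField Fock where
  mode := alpha
  exists_bound := alpha_bound

/-- The nested normally ordered product `:∂⁽ⁱ¹⁻¹⁾α(z) ⋯ ∂⁽ⁱᵏ⁻¹⁾α(z):` (the identity field for the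
empty list). -/
def wordField : List ℕ+ → FormalField Fock
  | [] => FormalField.one
  | i :: l => FormalField.normalOrder (alphaField.dividedDeriv ((i : ℕ) - 1)) (wordField l)

/-- The field `Y(x_{i₁} ⋯ x_{iₖ}, z) = :∂⁽ⁱ¹⁻¹⁾α(z) ⋯ ∂⁽ⁱᵏ⁻¹⁾α(z):` of a monomial. The factors are
taken in increasing order of their indices; the normally ordered product of these fields does not
depend on the order. -/
def monomialField (m : ℕ+ →₀ ℕ) : FormalField Fock :=
  wordField (Finsupp.toMultiset m).sort

/-- The products `a₍ₙ₎b` of the free bosonic vertex algebra: `Y(a, z) = ∑ₙ a₍ₙ₎ z⁻ⁿ⁻¹` is linear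
in `a` and is given on monomials by `monomialField`. The vacuum vector is `1`. -/
def nthProd (n : ℤ) : Fock →ₗ[ℂ] Module.End ℂ Fock :=
  (MvPolynomial.basisMonomials ℕ+ ℂ).constr ℂ fun m => (monomialField m).mode n

/-- The translation operator `T a = a₍₋₂₎1`. -/
def translation : Module.End ℂ Fock where
  toFun a := nthProd (-2) a 1
  map_add' a b := by simp
  map_smul' c a := by simp

/-- A Virasoro vector of central charge `c`. -/
structure IsVirasoroVector (v : Fock) (c : ℂ) : Prop where
  ne_zero : v ≠ 0
  prod_ge_four : ∀ n : ℤ, 4 ≤ n → nthProd n v v = 0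
  prod_three : nthProd 3 v v = (c / 2) • (1 : Fock)
  prod_two : nthProd 2 v v = 0
  prod_one : nthProd 1 v v = (2 : ℂ) • v
  prod_zero : nthProd 0 v v = translation v

/-- A conformal vector: a Virasoro vector (of some central charge) such that `L₀ = v₍₁₎` is
semisimple and `L₋₁ = v₍₀₎` is the translation operator. -/
structure IsConformalVector (v : Fock) : Prop where
  isVirasoro : ∃ c : ℂ, IsVirasoroVector v c
  isSemisimple : (nthProd 1 v).IsSemisimple
  eq_translation : nthProd 0 v = translation

/-- An automorphism of the vertex algebra: a linear automorphism preserving all the products. -/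
def IsAutomorphism (σ : Fock ≃ₗ[ℂ] Fock) : Prop :=
  ∀ (n : ℤ) (a b : Fock), σ (nthProd n a b) = nthProd n (σ a) (σ b)

/-- The Lie algebra `sl₂(ℂ)`. -/
abbrev SlTwo : Type := LieAlgebra.SpecialLinear.sl (Fin 2) ℂ

/-- The standard basis element `E` of `sl₂(ℂ)`. -/
def slE : SlTwo :=
  ⟨!![0, 1; 0, 0], by simp [LieAlgebra.SpecialLinear.sl, Matrix.trace_fin_two]⟩

/-- The standard basis element `H` of `sl₂(ℂ)`. -/
def slH : SlTwo :=
  ⟨!![1, 0; 0, -1], by simp [LieAlgebra.SpecialLinear.sl, Matrix.trace_fin_two]⟩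

/-- The standard basis element `F` of `sl₂(ℂ)`. -/
def slF : SlTwo :=
  ⟨!![0, 0; 1, 0], by simp [LieAlgebra.SpecialLinear.sl, Matrix.trace_fin_two]⟩

/-- `ρ` is the `sl₂(ℂ)`-module structure given by `v`, that is `E ↦ -L₁`, `H ↦ -2L₀`, `F ↦ L₋₁`,
where `Lₙ = v₍ₙ₊₁₎`. -/
structure IsSlTwoAction (v : Fock) (ρ : SlTwo →ₗ⁅ℂ⁆ Module.End ℂ Fock) : Prop where
  map_E : ρ slE = -nthProd 2 v
  map_H : ρ slH = -((2 : ℂ) • nthProd 1 v)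
  map_F : ρ slF = nthProd 0 v

/-- A representation of a complex Lie algebra is completely reducible if every submodule has a
complementary submodule. -/
def IsCompletelyReducible {L M : Type*} [LieRing L] [LieAlgebra ℂ L] [AddCommGroup M] [Module ℂ M]
    (ρ : L →ₗ⁅ℂ⁆ Module.End ℂ M) : Prop :=
  letI : LieRingModule L M := LieRingModule.compLieHom M ρ
  ComplementedLattice (LieSubmodule ℂ L M)

end

end FreeBoson

namespace FreeBoson

open MvPolynomial

/-! Every Virasoro vector of the free boson has the form `virasoroVec c t`, that is (x₁ + c)²/2 + t
x₂, and both sides of the equivalence hold exactly when t = 0.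

The classification (`IsVirasoroVector.exists_eq`) rests on the filtration by polynomial degree. A
product a₍ₙ₎b with n ≥ 0 needs at least one contraction, which costs two degrees. If f is the top
homogeneous part of v and m the largest index of a variable in f, then the leading term of v₍₂ₘ₋₁₎v
is a nonzero multiple of (∂f/∂xₘ)². The Virasoro relations then force m = 1, deg v = 2 and f =
x₁²/2. The remaining linear and constant coefficients are read off from v₍ₙ₎v for n ≥ 1.

The substitutions x₁ ↦ εx₁ + c, xᵢ ↦ εxᵢ with ε² = 1 are automorphisms
(`isAutomorphism_affineEquiv`). Those with ε = 1 reduce matters to c = 0. There L₋₁, L₀, L₁ are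
derivations of the polynomial ring, so the sl₂ relations need checking only on the variables.

If t ≠ 0, then L₁x₁ = -2t is a nonzero constant. This prevents the trivial submodule of constants
from having a complement (`not_forall_exists_isCompl`). It also rigidifies v: an automorphism fixing
v preserves the line of x₁ because it commutes with L₀, fixes x₁ because it commutes with L₁, and is
then the identity because x₁ generates V (`eq_refl_of_map_virasoroVec`).

If t = 0, the reflection x₁ + c ↦ -(x₁ + c), xᵢ ↦ -xᵢ fixes v. For c = 0 the Fock space carries a
positive definite Hermitian form with L₁ adjoint to L₋₁ and L₀ self-adjoint; as the L₀-eigenspaces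
are finite dimensional, orthogonal complements are complements (`exists_isCompl_of_isStable`). -/

/-! ### Heisenberg operators and the degree filtration -/

theorem alpha_zero : alpha 0 = 0 := rfl

theorem alpha_coe (k : ℕ+) (u : Fock) : alpha (k : ℤ) u = (k : ℂ) • pderiv k u := by
  obtain ⟨n, rfl⟩ : ∃ n : ℕ, k = n.succPNat := ⟨k.natPred, (PNat.succPNat_natPred k).symm⟩
  change ((n : ℂ) + 1) • pderiv n.succPNat u = _
  simp

theorem alpha_neg (k : ℕ+) (u : Fock) : alpha (-(k : ℤ)) u = X k * u := by
  obtain ⟨n, rfl⟩ : ∃ n : ℕ, k = n.succPNat := ⟨k.natPred, (PNat.succPNat_natPred k).symm⟩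
  have : (-((n.succPNat : ℕ) : ℤ)) = Int.negSucc n := by simp [Int.negSucc_eq]
  change alpha (-((n.succPNat : ℕ) : ℤ)) u = _
  rw [this]
  rfl

theorem exists_pnat_of_pos {n : ℤ} (hn : 0 < n) : ∃ k : ℕ+, n = (k : ℤ) :=
  ⟨⟨n.toNat, by omega⟩, by change n = (n.toNat : ℤ); omega⟩

/-- Polynomials of total degree at most `N`. -/
def degreeLE (N : ℤ) : Submodule ℂ Fock where
  carrier := {p | ∀ d : ℕ+ →₀ ℕ, N < d.degree → p.coeff d = 0}
  add_mem' hp hq d hd := by rw [coeff_add, hp d hd, hq d hd, add_zero]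
  zero_mem' d _ := coeff_zero d
  smul_mem' c p hp d hd := by rw [coeff_smul, hp d hd, smul_zero]

theorem degreeLE_mono {M N : ℤ} (h : M ≤ N) : degreeLE M ≤ degreeLE N :=
  fun _ hp d hd => hp d (by omega)

theorem degreeLE_neg {N : ℤ} (h : N < 0) {p : Fock} (hp : p ∈ degreeLE N) : p = 0 := by
  ext d
  rw [hp d (by omega), coeff_zero]

theorem X_mul_mem_degreeLE {N : ℤ} (k : ℕ+) {p : Fock} (hp : p ∈ degreeLE N) :
    X k * p ∈ degreeLE (N + 1) := by
  intro d hd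
  rw [coeff_X_mul']
  split_ifs with h
  · refine hp _ ?_
    have h1 : Finsupp.single k 1 ≤ d := by
      rw [Finsupp.single_le_iff]
      exact Nat.one_le_iff_ne_zero.mpr (Finsupp.mem_support_iff.mp h)
    have h2 : (d - Finsupp.single k 1).degree + 1 = d.degree := by
      conv_rhs => rw [← tsub_add_cancel_of_le h1]
      rw [map_add, Finsupp.degree_single]
    omega
  · rfl

theorem pderiv_mem_degreeLE {N : ℤ} (k : ℕ+) {p : Fock} (hp : p ∈ degreeLE N) :
    pderiv k p ∈ degreeLE (N - 1) := by
  intro d hd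
  rw [coeff_pderiv, hp _ (by rw [map_add, Finsupp.degree_single]; push_cast; omega)]
  simp

theorem alpha_mem_degreeLE_of_nonneg {N n : ℤ} (hn : 0 ≤ n) {p : Fock} (hp : p ∈ degreeLE N) :
    alpha n p ∈ degreeLE (N - 1) := by
  rcases hn.eq_or_lt with rfl | hn
  · exact Submodule.zero_mem _
  · obtain ⟨k, rfl⟩ := exists_pnat_of_pos hn
    rw [alpha_coe]
    exact Submodule.smul_mem _ _ (pderiv_mem_degreeLE k hp)

theorem alpha_mem_degreeLE {N : ℤ} (n : ℤ) {p : Fock} (hp : p ∈ degreeLE N) :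
    alpha n p ∈ degreeLE (N + 1) := by
  rcases le_or_gt 0 n with hn | hn
  · exact degreeLE_mono (by omega) (alpha_mem_degreeLE_of_nonneg hn hp)
  · obtain ⟨k, hk⟩ := exists_pnat_of_pos (neg_pos.mpr hn)
    obtain rfl : n = -(k : ℤ) := by omega
    rw [alpha_neg]
    exact X_mul_mem_degreeLE k hp

/-! ### Degree estimates for modes of normally ordered words -/

/-- The field `∂⁽ⁱ⁻¹⁾α(z)`, which is `Y(xᵢ, z)`. -/
noncomputable def derivField (i : ℕ+) : FormalField Fock := alphaField.dividedDeriv ((i : ℕ) - 1)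

theorem derivField_mode (i : ℕ+) (n : ℤ) :
    (derivField i).mode n = Ring.choose ((i : ℤ) - n - 2) ((i : ℕ) - 1) • alpha (n - i + 1) := by
  have h := i.pos
  have e : (((i : ℕ) - 1 : ℕ) : ℤ) = (i : ℤ) - 1 := by push_cast [Nat.cast_sub h]; simp
  change Ring.choose ((((i : ℕ) - 1 : ℕ) : ℤ) - n - 1) ((i : ℕ) - 1) •
    alpha (n - (((i : ℕ) - 1 : ℕ) : ℤ)) = _
  rw [e]
  congr 2 <;> ring

theorem derivField_mode_neg_one (i : ℕ+) (u : Fock) : (derivField i).mode (-1) u = X i * u := by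
  have h := i.pos
  have e : (i : ℤ) - (-1) - 2 = (((i : ℕ) - 1 : ℕ) : ℤ) := by push_cast [Nat.cast_sub h]; simp; ring
  rw [derivField_mode, e, Ring.choose_natCast, Nat.choose_self, Nat.cast_one, one_smul,
    show (-1 : ℤ) - i + 1 = -(i : ℤ) by ring, alpha_neg]

/-- At n = i - 1 the operator is α₀ = 0, and for smaller n ≥ 0 the binomial coefficient vanishes.
Hence the modes of non-negative index contain annihilation operators only. -/
theorem derivField_mode_of_lt (i : ℕ+) {n : ℤ} (h0 : 0 ≤ n) (hn : n < i) :
    (derivField i).mode n = 0 := by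
  rw [derivField_mode]
  rcases eq_or_ne n (i - 1) with rfl | hne
  · rw [show (i : ℤ) - 1 - i + 1 = 0 by ring, alpha_zero, smul_zero]
  · obtain ⟨k, hk⟩ := Int.eq_ofNat_of_zero_le (show 0 ≤ (i : ℤ) - n - 2 by omega)
    rw [hk, Ring.choose_natCast, Nat.choose_eq_zero_of_lt (by have := i.pos; omega), Nat.cast_zero,
      zero_smul]

theorem derivField_mem {N : ℤ} (i : ℕ+) (n : ℤ) {p : Fock} (hp : p ∈ degreeLE N) :
    (derivField i).mode n p ∈ degreeLE (N + 1) := by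
  rw [derivField_mode, LinearMap.smul_apply]
  exact zsmul_mem (alpha_mem_degreeLE _ hp) _

theorem derivField_mem_of_nonneg {N : ℤ} (i : ℕ+) {n : ℤ} (hn : 0 ≤ n) {p : Fock}
    (hp : p ∈ degreeLE N) : (derivField i).mode n p ∈ degreeLE (N - 1) := by
  rcases lt_or_ge n i with h | h
  · rw [derivField_mode_of_lt i hn h]
    exact Submodule.zero_mem _
  · rw [derivField_mode, LinearMap.smul_apply]
    exact zsmul_mem (alpha_mem_degreeLE_of_nonneg (by omega) hp) _

theorem normalOrder_mode {M : Type*} [AddCommGroup M] [Module ℂ M] (A B : FormalField M) (n : ℤ)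
    (u : M) : (A.normalOrder B).mode n u =
      ∑ᶠ j : ℕ, (A.mode (-(j : ℤ) - 1) (B.mode (n + j) u) + B.mode (n - j - 1) (A.mode j u)) := rfl

theorem normalOrder_mode_finite {M : Type*} [AddCommGroup M] [Module ℂ M] (A B : FormalField M)
    (n : ℤ) (u : M) : (Function.support fun j : ℕ =>
      (A.mode (-(j : ℤ) - 1) (B.mode (n + j) u) + B.mode (n - j - 1) (A.mode j u))).Finite :=
  FormalField.normalOrderTerm_finite A B n u

theorem creation_support_finite {M : Type*} [AddCommGroup M] [Module ℂ M] (A B : FormalField M)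
    (n : ℤ) (u : M) :
    (Function.support fun j : ℕ => A.mode (-(j : ℤ) - 1) (B.mode (n + j) u)).Finite := by
  obtain ⟨N, hN⟩ := B.exists_bound u
  refine (Set.finite_lt_nat (N - n).toNat).subset fun j hj => ?_
  by_contra hlt
  simp only [Set.mem_ofPred_eq, not_lt] at hlt
  exact hj (by simp only [hN (n + j) (by omega), map_zero])

theorem annihilation_support_finite {M : Type*} [AddCommGroup M] [Module ℂ M]
    (A B : FormalField M) (n : ℤ) (u : M) :
    (Function.support fun j : ℕ => B.mode (n - j - 1) (A.mode j u)).Finite := by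
  obtain ⟨N, hN⟩ := A.exists_bound u
  refine (Set.finite_lt_nat N.toNat).subset fun j hj => ?_
  by_contra hlt
  simp only [Set.mem_ofPred_eq, not_lt] at hlt
  exact hj (by simp only [hN j (by omega), map_zero])

theorem normalOrder_mode_eq_add {M : Type*} [AddCommGroup M] [Module ℂ M] (A B : FormalField M)
    (n : ℤ) (u : M) : (A.normalOrder B).mode n u =
      ∑ᶠ j : ℕ, A.mode (-(j : ℤ) - 1) (B.mode (n + j) u) +
        ∑ᶠ j : ℕ, B.mode (n - j - 1) (A.mode j u) :=
  finsum_add_distrib (creation_support_finite A B n u) (annihilation_support_finite A B n u)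

theorem finsum_mem_submodule {M ι : Type*} [AddCommGroup M] [Module ℂ M] (S : Submodule ℂ M)
    {f : ι → M} (h : ∀ i, f i ∈ S) : ∑ᶠ i, f i ∈ S :=
  finsum_induction (· ∈ S) S.zero_mem (fun _ _ => S.add_mem) h

theorem finsum_sub_mem_submodule {M ι : Type*} [AddCommGroup M] [Module ℂ M] (S : Submodule ℂ M)
    {f g : ι → M} (hf : f.support.Finite) (hg : g.support.Finite) (h : ∀ i, f i - g i ∈ S) :
    ∑ᶠ i, f i - ∑ᶠ i, g i ∈ S := by
  rw [← finsum_sub_distrib hf hg]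
  exact finsum_mem_submodule S h

theorem wordField_cons (i : ℕ+) (l : List ℕ+) :
    wordField (i :: l) = (derivField i).normalOrder (wordField l) := rfl

theorem one_mode (n : ℤ) (u : Fock) :
    (FormalField.one : FormalField Fock).mode n u = if n = -1 then u else 0 := by
  change (if n = -1 then LinearMap.id else 0 : Module.End ℂ Fock) u = _
  split_ifs <;> rfl

theorem wordField_mem (l : List ℕ+) {q : ℤ} (n : ℤ) {u : Fock} (hu : u ∈ degreeLE q) :
    (wordField l).mode n u ∈ degreeLE (q + l.length) := by
  induction l generalizing q n u with
  | nil =>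
    change (FormalField.one : FormalField Fock).mode n u ∈ _
    rw [one_mode]
    split_ifs
    · simpa using hu
    · exact Submodule.zero_mem _
  | cons i l ih =>
    rw [wordField_cons, normalOrder_mode]
    refine finsum_mem_submodule _ fun j => Submodule.add_mem _ ?_ ?_
    · refine degreeLE_mono ?_ (derivField_mem i _ (ih _ hu))
      simp only [List.length_cons]; push_cast; omega
    · refine degreeLE_mono ?_ (ih _ (derivField_mem_of_nonneg i (Int.natCast_nonneg j) hu))
      simp only [List.length_cons]; push_cast; omega

/-- Creation modes alone add up to a negative index, so every term contains an annihilation mode.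
That costs two degrees: one factor fewer multiplies, and one derivative is taken. -/
theorem wordField_mem_of_nonneg (l : List ℕ+) {q n : ℤ} (hn : 0 ≤ n) {u : Fock}
    (hu : u ∈ degreeLE q) : (wordField l).mode n u ∈ degreeLE (q + l.length - 2) := by
  induction l generalizing q n u with
  | nil =>
    change (FormalField.one : FormalField Fock).mode n u ∈ _
    rw [one_mode, if_neg (by omega)]
    exact Submodule.zero_mem _
  | cons i l ih =>
    rw [wordField_cons, normalOrder_mode]
    refine finsum_mem_submodule _ fun j => Submodule.add_mem _ ?_ ?_
    · refine degreeLE_mono ?_ (derivField_mem i _ (ih (by omega) hu))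
      simp only [List.length_cons]; push_cast; omega
    · refine degreeLE_mono ?_
        (wordField_mem l _ (derivField_mem_of_nonneg i (Int.natCast_nonneg j) hu))
      simp only [List.length_cons]; push_cast; omega

/-- Used to extract the leading term of a mode: modulo lower degree, only one summand of the
normally ordered product survives. -/
theorem finsum_sub_mem_of_ne {M : Type*} [AddCommGroup M] [Module ℂ M] (S : Submodule ℂ M)
    {f : ℕ → M} (hf : f.support.Finite) (i : ℕ) (a : M) (hi : f i - a ∈ S)
    (h : ∀ j, j ≠ i → f j ∈ S) : ∑ᶠ j, f j - a ∈ S := by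
  have hg : ∑ᶠ j, (if j = i then a else 0) = a := by
    rw [finsum_eq_single _ i fun j hj => if_neg hj, if_pos rfl]
  rw [← hg]
  refine finsum_sub_mem_submodule S hf
    ((Set.finite_singleton i).subset fun j hj => ?_) fun j => ?_
  · by_contra hne
    exact hj (if_neg hne)
  · split_ifs with hj
    · subst hj; exact hi
    · simpa using h j hj

theorem wordField_mode_neg_one_sub_mem (l : List ℕ+) {q : ℤ} {u : Fock} (hu : u ∈ degreeLE q) :
    (wordField l).mode (-1) u - (l.map X).prod * u ∈ degreeLE (q + l.length - 2) := by
  induction l generalizing q u with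
  | nil =>
    change (FormalField.one : FormalField Fock).mode (-1) u - _ ∈ _
    rw [one_mode, if_pos rfl]
    simp
  | cons i l ih =>
    rw [wordField_cons, normalOrder_mode]
    have key : ∀ j : ℕ, (wordField l).mode (-1 - j - 1) ((derivField i).mode j u) ∈
        degreeLE (q + (i :: l).length - 2) := fun j => by
      refine degreeLE_mono ?_
        (wordField_mem l _ (derivField_mem_of_nonneg i (Int.natCast_nonneg j) hu))
      simp only [List.length_cons]; push_cast; omega
    refine finsum_sub_mem_of_ne _ (normalOrder_mode_finite _ _ _ _) 0 _ ?_ fun j hj => ?_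
    · rw [add_sub_right_comm (_ : Fock)]
      refine Submodule.add_mem _ ?_ (key 0)
      simp only [Nat.cast_zero, neg_zero, zero_sub, add_zero]
      rw [derivField_mode_neg_one, List.map_cons, List.prod_cons, mul_assoc, ← mul_sub]
      refine degreeLE_mono ?_ (X_mul_mem_degreeLE i (ih hu))
      simp only [List.length_cons]; push_cast; omega
    · refine Submodule.add_mem _ ?_ (key j)
      refine degreeLE_mono ?_ (derivField_mem i _ (wordField_mem_of_nonneg l (by omega) hu))
      simp only [List.length_cons]; push_cast; omega

/-- The mode is a multiple of α with index n - i + 1 > m, hence of the derivative in a variable that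
is absent from u. -/
theorem derivField_mode_eq_zero {i m : ℕ+} {n : ℤ}
    (hn : (m : ℤ) + i - 1 < n) {u : Fock} (hu : ∀ k : ℕ+, m < k → pderiv k u = 0) :
    (derivField i).mode n u = 0 := by
  obtain ⟨k, hk⟩ := exists_pnat_of_pos (show 0 < n - i + 1 by have := m.pos; omega)
  have : m < k := by
    rw [← PNat.coe_lt_coe]; omega
  rw [derivField_mode, hk, LinearMap.smul_apply, alpha_coe, hu k this, smul_zero, smul_zero]

/-- A single contraction between variables of index at most m reaches only modes up to 2m - 1. From
2m on at least two contractions are needed, which costs four degrees. -/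
theorem wordField_mem_of_two_mul_le (l : List ℕ+) {m : ℕ+} (hl : ∀ i ∈ l, i ≤ m) {q n : ℤ}
    (hn : 2 * (m : ℤ) ≤ n) {u : Fock} (hu : u ∈ degreeLE q)
    (hm : ∀ k : ℕ+, m < k → pderiv k u = 0) :
    (wordField l).mode n u ∈ degreeLE (q + l.length - 4) := by
  have hm0 := m.pos
  induction l generalizing n with
  | nil =>
    change (FormalField.one : FormalField Fock).mode n u ∈ _
    rw [one_mode, if_neg (by omega)]
    exact Submodule.zero_mem _
  | cons i l ih =>
    have hi := hl i List.mem_cons_self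
    have hi' := PNat.coe_le_coe _ _ |>.mpr hi
    rw [wordField_cons, normalOrder_mode]
    refine finsum_mem_submodule _ fun j => Submodule.add_mem _ ?_ ?_
    · refine degreeLE_mono ?_ (derivField_mem i _
        (ih (fun k hk => hl k (List.mem_cons_of_mem _ hk)) (by omega)))
      simp only [List.length_cons]; push_cast; omega
    · rcases lt_or_ge ((m : ℤ) + i - 1) j with h | h
      · rw [derivField_mode_eq_zero h hm, map_zero]
        exact Submodule.zero_mem _
      · refine degreeLE_mono ?_ (wordField_mem_of_nonneg l (by omega)
          (derivField_mem_of_nonneg i (Int.natCast_nonneg j) hu))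
        simp only [List.length_cons]; push_cast; omega

/-! ### The leading term of the mode of index 2m - 1 -/

/-- The coefficient of the pole of highest order in the operator product `Y(xₘ, z) Y(xₘ, w)`. -/
noncomputable def poleCoeff (m : ℕ+) : ℂ :=
  (Ring.choose (-(m : ℤ) - 1) ((m : ℕ) - 1) : ℤ) * (m : ℂ)

theorem poleCoeff_one : poleCoeff 1 = 1 := by
  simp [poleCoeff]

theorem poleCoeff_ne_zero (m : ℕ+) : poleCoeff m ≠ 0 := by
  refine mul_ne_zero ?_ (by simp)
  -- Up to sign the binomial coefficient is binom(2m - 1, m - 1).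
  rw [show -(m : ℤ) - 1 = -((m : ℤ) + 1) by ring, Ring.choose_neg]
  have h := m.pos
  rw [show (m : ℤ) + 1 + (((m : ℕ) - 1 : ℕ) : ℤ) - 1 = ((2 * (m : ℕ) - 1 : ℕ) : ℤ) by omega,
    Ring.choose_natCast]
  have := (Nat.choose_pos (show (m : ℕ) - 1 ≤ 2 * (m : ℕ) - 1 by omega)).ne'
  rw [Units.smul_def, smul_eq_mul]
  exact Int.cast_ne_zero.mpr (mul_ne_zero (Units.ne_zero _) (Nat.cast_ne_zero.mpr this))

theorem derivField_mode_two_mul_sub_one (m : ℕ+) (u : Fock) :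
    (derivField m).mode (2 * (m : ℤ) - 1) u = poleCoeff m • pderiv m u := by
  rw [derivField_mode, show 2 * (m : ℤ) - 1 - m + 1 = m by ring,
    show (m : ℤ) - (2 * (m : ℤ) - 1) - 2 = -(m : ℤ) - 1 by ring, LinearMap.smul_apply, alpha_coe,
    poleCoeff, mul_smul, Int.cast_smul_eq_zsmul]

/-- The only single contraction that reaches this mode pairs a factor xₘ of the word with an xₘ of
u. Choosing the factor is a derivation, and the two kinds of summands in the normally ordered
product match the two terms of the Leibniz rule for xᵢ times the rest. -/
theorem wordField_mode_two_mul_sub_one_sub_mem (l : List ℕ+) {m : ℕ+} (hl : ∀ i ∈ l, i ≤ m)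
    {q : ℤ} {u : Fock} (hu : u ∈ degreeLE q) (hm : ∀ k : ℕ+, m < k → pderiv k u = 0) :
    (wordField l).mode (2 * (m : ℤ) - 1) u - poleCoeff m • (pderiv m (l.map X).prod * pderiv m u) ∈
      degreeLE (q + l.length - 4) := by
  have hm0 := m.pos
  induction l with
  | nil =>
    change (FormalField.one : FormalField Fock).mode _ u - _ ∈ _
    rw [one_mode, if_neg (by omega)]
    simp
  | cons i l ih =>
    have hi := hl i List.mem_cons_self
    have hi' := PNat.coe_le_coe _ _ |>.mpr hi
    have hl' : ∀ k ∈ l, k ≤ m := fun k hk => hl k (List.mem_cons_of_mem _ hk)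
    rw [wordField_cons, normalOrder_mode_eq_add]
    rw [List.map_cons, List.prod_cons, pderiv_mul, add_comm (pderiv m (X i) * _), add_mul, smul_add,
      add_sub_add_comm]
    refine Submodule.add_mem _ ?_ ?_
    · refine finsum_sub_mem_of_ne _ (creation_support_finite _ _ _ _) 0 _ ?_ fun j hj => ?_
      · simp only [Nat.cast_zero, neg_zero, zero_sub, add_zero]
        rw [derivField_mode_neg_one, mul_assoc, ← mul_smul_comm, ← mul_sub]
        refine degreeLE_mono ?_ (X_mul_mem_degreeLE i (ih hl'))
        simp only [List.length_cons]; push_cast; omega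
      · refine degreeLE_mono ?_ (derivField_mem i _
          (wordField_mem_of_two_mul_le l hl' (by omega) hu hm))
        simp only [List.length_cons]; push_cast; omega
    -- For j = 2m - 1 the rest of the word acts by its mode -1, to leading order multiplication. A
    -- larger j kills u, and a smaller one leaves a non-negative mode, hence a second contraction.
    · refine finsum_sub_mem_of_ne _ (annihilation_support_finite _ _ _ _) (2 * (m : ℕ) - 1) _
        ?_ fun j hj => ?_
      · have e : ((2 * (m : ℕ) - 1 : ℕ) : ℤ) = 2 * (m : ℤ) - 1 := by omega
        simp only [e, sub_self, zero_sub]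
        rcases eq_or_ne i m with rfl | hne
        · rw [derivField_mode_two_mul_sub_one, pderiv_X_self, one_mul, map_smul, ← smul_sub]
          refine Submodule.smul_mem _ _ (degreeLE_mono ?_
            (wordField_mode_neg_one_sub_mem l (pderiv_mem_degreeLE i hu)))
          simp only [List.length_cons]; push_cast; omega
        · have hlt : (i : ℕ) < m := PNat.coe_lt_coe _ _ |>.mpr (lt_of_le_of_ne hi hne)
          rw [derivField_mode_eq_zero (by omega) hm, map_zero, pderiv_X_of_ne hne]
          simp
      · rcases lt_or_ge ((m : ℤ) + i - 1) j with h | h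
        · rw [derivField_mode_eq_zero h hm, map_zero]
          exact Submodule.zero_mem _
        · refine degreeLE_mono ?_ (wordField_mem_of_nonneg l (by omega)
            (derivField_mem_of_nonneg i (Int.natCast_nonneg j) hu))
          simp only [List.length_cons]; push_cast; omega

/-! ### Degree estimates for the products of the vertex algebra -/

theorem nthProd_monomial (n : ℤ) (d : ℕ+ →₀ ℕ) (c : ℂ) :
    nthProd n (monomial d c) = c • (wordField (Finsupp.toMultiset d).sort).mode n := by
  have h : monomial d c = c • (basisMonomials ℕ+ ℂ d) := by
    rw [coe_basisMonomials, smul_monomial, smul_eq_mul, mul_one]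
  rw [h, map_smul, nthProd, Module.Basis.constr_basis]
  rfl

theorem length_sort_toMultiset (d : ℕ+ →₀ ℕ) : (Finsupp.toMultiset d).sort.length = d.degree := by
  rw [Multiset.length_sort, Finsupp.card_toMultiset, Finsupp.degree_apply, Finsupp.sum]; rfl

theorem prod_map_X_sort_toMultiset (d : ℕ+ →₀ ℕ) :
    ((Finsupp.toMultiset d).sort.map X).prod = (monomial d 1 : Fock) := by
  rw [← Multiset.prod_coe, ← Multiset.map_coe, Multiset.sort_eq, Finsupp.toMultiset_map,
    Finsupp.prod_toMultiset, Finsupp.prod_mapDomain_index (fun _ => pow_zero _)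
      (fun _ _ _ => pow_add _ _ _), monomial_eq, C_1, one_mul]

theorem mem_sort_toMultiset {d : ℕ+ →₀ ℕ} {i : ℕ+} :
    i ∈ (Finsupp.toMultiset d).sort ↔ i ∈ d.support := by
  rw [Multiset.mem_sort, Finsupp.mem_toMultiset]

theorem nthProd_eq_sum (n : ℤ) (a u : Fock) : nthProd n a u =
    ∑ d ∈ a.support, coeff d a • (wordField (Finsupp.toMultiset d).sort).mode n u := by
  conv_lhs => rw [a.as_sum]
  rw [map_sum, LinearMap.sum_apply]
  exact Finset.sum_congr rfl fun d _ => by rw [nthProd_monomial, LinearMap.smul_apply]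

theorem nthProd_mem_degreeLE {p q n : ℤ} (hn : 0 ≤ n) {a u : Fock} (ha : a ∈ degreeLE p)
    (hu : u ∈ degreeLE q) : nthProd n a u ∈ degreeLE (p + q - 2) := by
  rw [nthProd_eq_sum]
  refine Submodule.sum_mem _ fun d hd => Submodule.smul_mem _ _ ?_
  refine degreeLE_mono ?_ (wordField_mem_of_nonneg _ hn hu)
  rw [length_sort_toMultiset]
  have : ¬ p < d.degree := fun h => mem_support_iff.mp hd (ha d h)
  omega

theorem nthProd_sub_mem_degreeLE {m : ℕ+} {p q : ℤ} {a u : Fock} (ha : a ∈ degreeLE p)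
    (ham : ∀ i ∈ a.vars, i ≤ m) (hu : u ∈ degreeLE q) (hum : ∀ i ∈ u.vars, i ≤ m) :
    nthProd (2 * (m : ℤ) - 1) a u - poleCoeff m • (pderiv m a * pderiv m u) ∈
      degreeLE (p + q - 4) := by
  have e : poleCoeff m • (pderiv m a * pderiv m u) = ∑ d ∈ a.support, coeff d a •
      (poleCoeff m • (pderiv m (monomial d 1) * pderiv m u)) := by
    conv_lhs => rw [a.as_sum]
    rw [map_sum, Finset.sum_mul, Finset.smul_sum]
    refine Finset.sum_congr rfl fun d _ => ?_
    rw [show monomial d (coeff d a) = coeff d a • monomial d (1 : ℂ) by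
      rw [smul_monomial, smul_eq_mul, mul_one], Derivation.map_smul, smul_mul_assoc, smul_comm]
  rw [e, nthProd_eq_sum, ← Finset.sum_sub_distrib]
  refine Submodule.sum_mem _ fun d hd => ?_
  rw [← smul_sub, ← prod_map_X_sort_toMultiset]
  refine Submodule.smul_mem _ _ ?_
  refine degreeLE_mono ?_ (wordField_mode_two_mul_sub_one_sub_mem _ (fun i hi => ?_) hu
    fun k hk => pderiv_eq_zero_of_notMem_vars fun h => hk.not_ge (hum k h))
  · rw [length_sort_toMultiset]
    have : ¬ p < d.degree := fun h => mem_support_iff.mp hd (ha d h)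
    omega
  · exact ham i ((mem_vars_iff_mem_support i).mpr ⟨d, hd, mem_sort_toMultiset.mp hi⟩)

/-! ### The top-degree part of a Virasoro vector -/

theorem mem_degreeLE_totalDegree (v : Fock) : v ∈ degreeLE v.totalDegree := by
  intro d hd
  exact coeff_eq_zero_of_totalDegree_lt (by
    have : v.totalDegree < d.degree := by exact_mod_cast hd
    simpa [Finsupp.degree_apply] using this)

theorem totalDegree_le_of_mem {v : Fock} {n : ℕ} (h : v ∈ degreeLE n) : v.totalDegree ≤ n := by
  refine Finset.sup_le fun d hd => ?_
  by_contra hlt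
  refine mem_support_iff.mp hd (h d ?_)
  rw [Finsupp.degree_apply]
  exact_mod_cast not_le.mp hlt

theorem IsHomogeneous.notMem_degreeLE {f : Fock} {n : ℕ} (hf : f.IsHomogeneous n) (h0 : f ≠ 0)
    {N : ℤ} (hN : N < n) : f ∉ degreeLE N := by
  intro h
  obtain ⟨d, hd⟩ := ne_zero_iff.mp h0
  have : d.degree = n := by
    by_contra hne
    exact hd (hf.coeff_eq_zero hne)
  exact hd (h d (by omega))

theorem homogeneousComponent_sub_mem (v : Fock) :
    v - homogeneousComponent v.totalDegree v ∈ degreeLE ((v.totalDegree : ℤ) - 1) := by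
  intro d hd
  rw [coeff_sub, coeff_homogeneousComponent]
  split_ifs with h
  · exact sub_self _
  · rw [sub_zero]
    exact mem_degreeLE_totalDegree v d (by omega)

theorem pderiv_ne_zero_of_mem_vars {f : Fock} {i : ℕ+} (hi : i ∈ f.vars) : pderiv i f ≠ 0 := by
  obtain ⟨d, hd, hid⟩ := (mem_vars_iff_mem_support i).mp hi
  refine ne_zero_iff.mpr ⟨d - Finsupp.single i 1, ?_⟩
  rw [coeff_pderiv, tsub_add_cancel_of_le (Finsupp.single_le_iff.mpr
    (Nat.one_le_iff_ne_zero.mpr (Finsupp.mem_support_iff.mp hid)))]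
  refine mul_ne_zero (mem_support_iff.mp hd) ?_
  exact Nat.cast_add_one_ne_zero _

theorem homogeneousComponent_totalDegree_ne_zero {v : Fock} (hv : v ≠ 0) :
    homogeneousComponent v.totalDegree v ≠ 0 := by
  intro h0
  have := homogeneousComponent_sub_mem v
  rw [h0, sub_zero] at this
  rcases Nat.eq_zero_or_pos v.totalDegree with h | h
  · exact hv (degreeLE_neg (by omega) this)
  · have := totalDegree_le_of_mem (n := v.totalDegree - 1) (by rwa [Nat.cast_sub h])
    omega

/-- The part of polynomial degree `2` of a Virasoro vector is `x₁² / 2`. -/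
theorem IsVirasoroVector.sub_mem_degreeLE_one {v : Fock} {c : ℂ} (hv : IsVirasoroVector v c) :
    v - C (1 / 2) * (X 1 * X 1) ∈ degreeLE 1 := by
  set p := v.totalDegree with hp
  have hvp := mem_degreeLE_totalDegree v
  rw [← hp] at hvp
  have hmem2 : ∀ {N : ℤ}, nthProd 1 v v ∈ degreeLE N → v ∈ degreeLE N := fun {N} h => by
    rw [hv.prod_one] at h
    simpa using Submodule.smul_mem _ (2⁻¹ : ℂ) h
  -- The vector 2v = v₍₁₎v has degree at most 2p - 2, which is less than p if p < 2.
  have hp2 : 2 ≤ p := by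
    by_contra hlt
    have h := hmem2 (nthProd_mem_degreeLE zero_le_one hvp hvp)
    rcases Nat.eq_zero_or_pos p with h0 | h0
    · exact hv.ne_zero (degreeLE_neg (by omega) h)
    · have := totalDegree_le_of_mem (n := 0) (degreeLE_mono (by omega) h)
      omega
  set f := homogeneousComponent p v with hf
  have hf0 : f ≠ 0 := homogeneousComponent_totalDegree_ne_zero hv.ne_zero
  have hfh : f.IsHomogeneous p := homogeneousComponent_isHomogeneous p v
  have hfp : f ∈ degreeLE p := fun d hd => hfh.coeff_eq_zero (by omega)
  have hg : v - f ∈ degreeLE ((p : ℤ) - 1) := homogeneousComponent_sub_mem v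
  have hvars : f.vars.Nonempty := by
    rw [Finset.nonempty_iff_ne_empty, Ne, vars_eq_empty_iff_eq_C]
    intro h
    have h0 : coeff 0 f = 0 := hfh.coeff_eq_zero (by rw [map_zero]; omega)
    rw [h0, C_0] at h
    exact hf0 h
  obtain ⟨m, hm, hmax⟩ := f.vars.exists_max_image id hvars
  have hmax : ∀ i ∈ f.vars, i ≤ m := hmax
  have key : nthProd (2 * (m : ℤ) - 1) v v - poleCoeff m • (pderiv m f * pderiv m f) ∈
      degreeLE (2 * p - 3) := by
    have hn : 0 ≤ 2 * (m : ℤ) - 1 := by have := m.pos; omega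
    have e : nthProd (2 * (m : ℤ) - 1) v v = nthProd (2 * (m : ℤ) - 1) f f +
        nthProd (2 * (m : ℤ) - 1) f (v - f) + nthProd (2 * (m : ℤ) - 1) (v - f) v := by
      simp only [map_sub, LinearMap.sub_apply]; abel
    rw [e, add_assoc, add_sub_right_comm]
    refine Submodule.add_mem _ ?_ (Submodule.add_mem _ ?_ ?_)
    · exact degreeLE_mono (by omega) (nthProd_sub_mem_degreeLE hfp hmax hfp hmax)
    · exact degreeLE_mono (by omega) (nthProd_mem_degreeLE hn hfp hg)
    · exact degreeLE_mono (by omega) (nthProd_mem_degreeLE hn hg hvp)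
  -- The square is nonzero because polynomials form a domain, and it is homogeneous of degree 2p -
  -- 2.
  have hsq : pderiv m f * pderiv m f ∉ degreeLE (2 * p - 3) := by
    have h1 := hfh.pderiv (i := m)
    have h0 := pderiv_ne_zero_of_mem_vars hm
    exact IsHomogeneous.notMem_degreeLE (h1.mul h1) (mul_ne_zero h0 h0) (by omega)
  have hout : nthProd (2 * (m : ℤ) - 1) v v ∉ degreeLE (2 * p - 3) := fun h => by
    refine hsq ?_
    have := Submodule.smul_mem _ (poleCoeff m)⁻¹ (Submodule.sub_mem _ h key)
    rwa [sub_sub_cancel, inv_smul_smul₀ (poleCoeff_ne_zero m)] at this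
  -- For m ≥ 2 the index 2m - 1 is at least 3, where v₍ₙ₎v is a constant; but 2p - 3 ≥ 1.
  have hm1 : m = 1 := by
    by_contra hne
    have hlt : 2 ≤ (m : ℕ) := by
      have := PNat.coe_lt_coe _ _ |>.mpr (lt_of_le_of_ne one_le (Ne.symm hne))
      exact_mod_cast this
    refine hout ?_
    rcases eq_or_lt_of_le hlt with h | h
    · rw [← h]
      norm_num
      rw [hv.prod_three]
      refine Submodule.smul_mem _ _ fun d hd => ?_
      rw [coeff_one, if_neg]
      rintro rfl
      simp at hd
      omega
    · rw [hv.prod_ge_four _ (by omega)]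
      exact Submodule.zero_mem _
  subst hm1
  norm_num at key hout
  -- Now v₍₁₎v = 2v has degree p, while its leading term has degree 2p - 2.
  have hp3 : p = 2 := by
    by_contra hne
    refine hout ?_
    rw [hv.prod_one]
    exact Submodule.smul_mem _ _ (degreeLE_mono (by omega) hvp)
  have hcoeff : ∀ d : ℕ+ →₀ ℕ, d.degree = 2 → d ≠ Finsupp.single 1 2 → coeff d v = 0 := by
    intro d hd hne
    by_contra h0
    have hdf : d ∈ f.support := by
      rw [mem_support_iff, hf, coeff_homogeneousComponent, if_pos (by omega)]
      exact h0
    have hz : ∀ i, i ≠ 1 → d i = 0 := fun i hi => by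
      by_contra hdi
      exact hi (le_antisymm (hmax i ((mem_vars_iff_mem_support i).mpr
        ⟨d, hdf, Finsupp.mem_support_iff.mpr hdi⟩))
        one_le)
    have hs : d = Finsupp.single 1 (d 1) := by
      ext i
      rcases eq_or_ne i 1 with rfl | hi
      · simp
      · rw [hz i hi, Finsupp.single_eq_of_ne hi]
    rw [hs, Finsupp.degree_single] at hd
    rw [hd] at hs
    exact hne hs
  have hfm : f = monomial (Finsupp.single 1 2) (coeff (Finsupp.single 1 2) v) := by
    ext d
    rw [hf, coeff_homogeneousComponent, coeff_monomial, hp3]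
    split_ifs with h1 h2 h2
    · rw [h2]
    · exact hcoeff d h1 (Ne.symm h2)
    · rw [← h2, Finsupp.degree_single] at h1
      exact absurd rfl h1
    · rfl
  -- With f = a x₁², comparing leading terms of v₍₁₎v = 2v gives 4a² = 2a.
  have ha : coeff (Finsupp.single 1 2) v = 1 / 2 := by
    set a := coeff (Finsupp.single 1 2) v with ha
    have ha0 : a ≠ 0 := fun h => hf0 (by rw [hfm, h, monomial_zero])
    rw [hfm, pderiv_monomial_single, monomial_mul, ← Finsupp.single_add, poleCoeff_one, one_smul,
      hv.prod_one] at key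
    have := key (Finsupp.single 1 2) (by rw [Finsupp.degree_single, hp3]; norm_num)
    rw [coeff_sub, coeff_smul, ← ha, coeff_monomial, if_pos rfl, smul_eq_mul] at this
    have h2 : a * (1 - 2 * a) = 0 := by push_cast at this; linear_combination this / 2
    rcases mul_eq_zero.mp h2 with h | h
    · exact absurd h ha0
    · linear_combination -h / 2
  rw [ha, ← C_mul_X_pow_eq_monomial, pow_two] at hfm
  rw [← hfm]
  exact degreeLE_mono (by omega) hg

/-! ### Normally ordered products of vertex fields, and the modes of x₁² -/

theorem FormalField.ext_mode {M : Type*} [AddCommGroup M] [Module ℂ M] {A B : FormalField M}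
    (h : ∀ n u, A.mode n u = B.mode n u) : A = B := by
  cases A; cases B
  congr
  exact funext fun n => LinearMap.ext (h n)

/-- The field `Y(a, z)`. -/
noncomputable def vertexField (a : Fock) : FormalField Fock where
  mode n := nthProd n a
  exists_bound u := by
    choose N hN using fun d : ℕ+ →₀ ℕ => (wordField (Finsupp.toMultiset d).sort).exists_bound u
    obtain ⟨K, hK⟩ := (a.support.image N).exists_le
    refine ⟨K, fun n hn => ?_⟩
    rw [nthProd_eq_sum]
    refine Finset.sum_eq_zero fun d hd => ?_
    rw [hN d n ((hK _ (Finset.mem_image_of_mem _ hd)).trans hn), smul_zero]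

theorem vertexField_mode (a : Fock) (n : ℤ) : (vertexField a).mode n = nthProd n a := rfl

theorem nthProd_C (n : ℤ) (c : ℂ) (u : Fock) : nthProd n (C c) u = if n = -1 then c • u else 0 := by
  change nthProd n (monomial 0 c) u = _
  rw [nthProd_monomial, map_zero, Multiset.sort_zero, LinearMap.smul_apply]
  change c • (FormalField.one : FormalField Fock).mode n u = _
  rw [one_mode, smul_ite, smul_zero]

theorem nthProd_one (n : ℤ) (u : Fock) : nthProd n 1 u = if n = -1 then u else 0 := by
  rw [← C_1, nthProd_C, one_smul]

theorem normalOrder_one {M : Type*} [AddCommGroup M] [Module ℂ M] (A : FormalField M) :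
    A.normalOrder FormalField.one = A := by
  refine FormalField.ext_mode fun n u => ?_
  have h : ∀ (k : ℤ) (w : M), (FormalField.one : FormalField M).mode k w =
      if k = -1 then w else 0 := fun k w => by
    change (if k = -1 then LinearMap.id else 0 : Module.End ℂ M) w = _
    split_ifs <;> rfl
  rw [normalOrder_mode]
  simp only [h, apply_ite (A.mode _), map_zero]
  rcases lt_or_ge n 0 with hn | hn
  · rw [finsum_eq_single _ (-1 - n).toNat fun j hj => by
      rw [if_neg (by omega), if_neg (by omega), add_zero]]
    rw [if_pos (by omega), if_neg (by omega), add_zero]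
    congr 2; omega
  · rw [finsum_eq_single _ n.toNat fun j hj => by
      rw [if_neg (by omega), if_neg (by omega), add_zero]]
    rw [if_neg (by omega), if_pos (by omega), zero_add]
    congr 2; omega

theorem nthProd_X (n : ℤ) (i : ℕ+) : nthProd n (X i) = (derivField i).mode n := by
  rw [X, nthProd_monomial, one_smul, Finsupp.toMultiset_single, one_smul, Multiset.sort_singleton,
    wordField_cons]
  exact congrArg (fun A => FormalField.mode A n) (normalOrder_one _)

theorem derivField_one_mode (n : ℤ) : (derivField 1).mode n = alpha n := by
  rw [derivField_mode]
  simp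

theorem nthProd_X_one (n : ℤ) : nthProd n (X 1) = alpha n := by
  rw [nthProd_X, derivField_one_mode]

theorem normalOrder_mode_add_right {M : Type*} [AddCommGroup M] [Module ℂ M]
    (A B B₁ B₂ : FormalField M) (h : ∀ n, B.mode n = B₁.mode n + B₂.mode n) (n : ℤ) :
    (A.normalOrder B).mode n = (A.normalOrder B₁).mode n + (A.normalOrder B₂).mode n := by
  ext1 u
  rw [LinearMap.add_apply]
  simp only [normalOrder_mode]
  rw [← finsum_add_distrib (normalOrder_mode_finite A B₁ n u) (normalOrder_mode_finite A B₂ n u)]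
  refine finsum_congr fun j => ?_
  simp only [h, LinearMap.add_apply, map_add]
  abel

theorem normalOrder_mode_smul_right {M : Type*} [AddCommGroup M] [Module ℂ M]
    (A B B₁ : FormalField M) (c : ℂ) (h : ∀ n, B.mode n = c • B₁.mode n) (n : ℤ) :
    (A.normalOrder B).mode n = c • (A.normalOrder B₁).mode n := by
  ext1 u
  rw [LinearMap.smul_apply]
  simp only [normalOrder_mode]
  rw [smul_finsum' _ (normalOrder_mode_finite A B₁ n u)]
  refine finsum_congr fun j => ?_
  simp only [h, LinearMap.smul_apply, map_smul, smul_add]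

theorem normalOrder_mode_add_left {M : Type*} [AddCommGroup M] [Module ℂ M]
    (A A₁ A₂ B : FormalField M) (h : ∀ n, A.mode n = A₁.mode n + A₂.mode n) (n : ℤ) :
    (A.normalOrder B).mode n = (A₁.normalOrder B).mode n + (A₂.normalOrder B).mode n := by
  ext1 u
  rw [LinearMap.add_apply]
  simp only [normalOrder_mode]
  rw [← finsum_add_distrib (normalOrder_mode_finite A₁ B n u) (normalOrder_mode_finite A₂ B n u)]
  refine finsum_congr fun j => ?_
  simp only [h, LinearMap.add_apply, map_add]
  abel

theorem normalOrder_mode_smul_left {M : Type*} [AddCommGroup M] [Module ℂ M]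
    (A A₁ B : FormalField M) (c : ℂ) (h : ∀ n, A.mode n = c • A₁.mode n) (n : ℤ) :
    (A.normalOrder B).mode n = c • (A₁.normalOrder B).mode n := by
  ext1 u
  rw [LinearMap.smul_apply]
  simp only [normalOrder_mode]
  rw [smul_finsum' _ (normalOrder_mode_finite A₁ B n u)]
  refine finsum_congr fun j => ?_
  simp only [h, LinearMap.smul_apply, map_smul, smul_add]

theorem one_normalOrder {M : Type*} [AddCommGroup M] [Module ℂ M] (A : FormalField M) :
    FormalField.one.normalOrder A = A := by
  refine FormalField.ext_mode fun n u => ?_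
  have h : ∀ (k : ℤ) (w : M), (FormalField.one : FormalField M).mode k w =
      if k = -1 then w else 0 := fun k w => by
    change (if k = -1 then LinearMap.id else 0 : Module.End ℂ M) w = _
    split_ifs <;> rfl
  rw [normalOrder_mode]
  simp only [h]
  rw [finsum_eq_single _ 0 fun j hj => by
      rw [if_neg (by omega), if_neg (by omega), map_zero, add_zero]]
  simp

/-- `Y(xᵢ a, z) = :Y(xᵢ, z) Y(a, z):` whenever `i` is at most all indices of variables in `a`. -/
theorem nthProd_X_mul_monomial (n : ℤ) (i : ℕ+) (d : ℕ+ →₀ ℕ) (hd : ∀ k ∈ d.support, i ≤ k) :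
    nthProd n (X i * monomial d 1) =
      ((derivField i).normalOrder (vertexField (monomial d 1))).mode n := by
  have h1 : X i * monomial d (1 : ℂ) = monomial (Finsupp.single i 1 + d) 1 := by
    rw [X, monomial_mul, one_mul]
  have h2 : (Finsupp.toMultiset (Finsupp.single i 1 + d)).sort =
      i :: (Finsupp.toMultiset d).sort := by
    rw [map_add, Finsupp.toMultiset_single, one_smul, Multiset.singleton_add,
      Multiset.sort_cons _ _ _ fun k hk => hd k ((Finsupp.mem_toMultiset _ _).mp hk)]
  rw [h1, nthProd_monomial, one_smul, h2, wordField_cons]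
  congr 2
  refine FormalField.ext_mode fun k u => ?_
  rw [vertexField_mode, nthProd_monomial, one_smul]

/-- Words are sorted and x₁ is the smallest variable, so it always comes first. Unlike for a general
xᵢ, no restriction on a is needed. -/
theorem nthProd_X_one_mul (n : ℤ) (a : Fock) :
    nthProd n (X 1 * a) = (alphaField.normalOrder (vertexField a)).mode n := by
  have h1 : alphaField = derivField 1 := FormalField.ext_mode fun k u => by
    rw [derivField_one_mode]; rfl
  rw [h1]
  induction a using MvPolynomial.induction_on' with
  | monomial d c =>
    have hc : monomial d c = c • monomial d (1 : ℂ) := by rw [smul_monomial, smul_eq_mul, mul_one]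
    rw [hc, mul_smul_comm, map_smul, nthProd_X_mul_monomial n 1 d fun k _ => one_le]
    exact (normalOrder_mode_smul_right _ _ _ c (fun k => by simp [vertexField_mode]) n).symm
  | add p q hp hq =>
    rw [mul_add, map_add, hp, hq]
    exact (normalOrder_mode_add_right _ _ _ _ (fun k => by simp [vertexField_mode]) n).symm

theorem nthProd_X_one_sq (n : ℤ) (u : Fock) : nthProd n (X 1 * X 1) u =
    ∑ᶠ j : ℕ, alpha (-(j : ℤ) - 1) (alpha (n + j) u) +
      ∑ᶠ j : ℕ, alpha (n - j - 1) (alpha j u) := by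
  rw [nthProd_X_one_mul, normalOrder_mode_eq_add]
  simp only [vertexField_mode, nthProd_X_one]
  rfl

theorem wordField_mode_one (l : List ℕ+) {n : ℤ} (hn : -1 ≤ n) :
    (wordField l).mode n 1 = if n = -1 then (l.map X).prod else 0 := by
  induction l generalizing n with
  | nil =>
    change (FormalField.one : FormalField Fock).mode n 1 = _
    rw [one_mode]; rfl
  | cons i l ih =>
    have h1 : ∀ k : ℕ, (derivField i).mode k 1 = 0 := fun k => by
      refine degreeLE_neg (N := 0 - 1) (by norm_num)
        (derivField_mem_of_nonneg i (Int.natCast_nonneg k) fun d hd => ?_)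
      rw [coeff_one, if_neg]
      rintro rfl
      simp at hd
    rw [wordField_cons, normalOrder_mode]
    simp only [h1, map_zero, add_zero]
    rw [finsum_eq_single _ 0 fun j hj => by rw [ih (by omega), if_neg (by omega), map_zero]]
    rw [ih (by simpa using hn)]
    simp only [Nat.cast_zero, neg_zero, zero_sub, add_zero, apply_ite ((derivField i).mode (-1)),
      map_zero, derivField_mode_neg_one, List.map_cons, List.prod_cons]

theorem nthProd_neg_one_one (a : Fock) : nthProd (-1) a 1 = a := by
  rw [nthProd_eq_sum]
  conv_rhs => rw [a.as_sum]
  refine Finset.sum_congr rfl fun d _ => ?_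
  rw [wordField_mode_one _ le_rfl, if_pos rfl, prod_map_X_sort_toMultiset, smul_monomial,
    smul_eq_mul, mul_one]

theorem eq_sum_of_mem_degreeLE_one {f : Fock} (hf : f ∈ degreeLE 1) {s : Finset ℕ+}
    (hs : f.vars ⊆ s) : f = C (coeff 0 f) + ∑ i ∈ s, coeff (Finsupp.single i 1) f • X i := by
  ext d
  have hX : ∀ i : ℕ+, coeff d (X i : Fock) = if Finsupp.single i 1 = d then 1 else 0 := fun i =>
    coeff_X i d
  simp only [coeff_add, coeff_C, coeff_sum, coeff_smul, hX, smul_eq_mul, mul_ite, mul_one, mul_zero]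
  rcases lt_or_ge 1 d.degree with h | h
  · rw [hf d (by exact_mod_cast h), if_neg, zero_add, Finset.sum_eq_zero]
    · intro i _
      rw [if_neg]
      rintro rfl
      simp at h
    · rintro rfl
      simp at h
  · rcases Nat.le_one_iff_eq_zero_or_eq_one.mp h with h | h
    · obtain rfl := (Finsupp.degree_eq_zero_iff d).mp h
      simp
    · obtain ⟨k, rfl⟩ : d ∈ Set.range fun k : ℕ+ => Finsupp.single k 1 := by
        rw [Finsupp.range_single_one]; exact h
      beta_reduce
      rw [if_neg (Ne.symm (Finsupp.single_ne_zero.mpr one_ne_zero)), zero_add]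
      simp only [Finsupp.single_left_inj one_ne_zero]
      rw [Finset.sum_ite_eq' s k]
      split_ifs with hk
      · rfl
      · by_contra h0
        exact hk (hs ((mem_vars_iff_mem_support k).mpr ⟨_, mem_support_iff.mpr h0, by simp⟩))

theorem alpha_X_of_nonneg {n : ℤ} (hn : 0 ≤ n) (i : ℕ+) :
    alpha n (X i) = if n = i then C (i : ℂ) else 0 := by
  rcases hn.eq_or_lt with rfl | hn
  · rw [if_neg (by have := i.pos; omega)]; rfl
  · obtain ⟨k, rfl⟩ := exists_pnat_of_pos hn
    rw [alpha_coe]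
    rcases eq_or_ne k i with rfl | hne
    · rw [pderiv_X_self, if_pos rfl, smul_eq_C_mul, mul_one]
    · rw [pderiv_X_of_ne hne.symm, smul_zero, if_neg]
      exact fun h => hne (PNat.coe_injective (by exact_mod_cast h))

theorem alpha_C_of_nonneg {n : ℤ} (hn : 0 ≤ n) (a : ℂ) : alpha n (C a) = 0 := by
  rcases hn.eq_or_lt with rfl | hn
  · rfl
  · obtain ⟨k, rfl⟩ := exists_pnat_of_pos hn
    rw [alpha_coe, pderiv_C, smul_zero]

theorem alpha_X_one_sq_of_nonneg {n : ℤ} (hn : 0 ≤ n) :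
    alpha n (X 1 * X 1) = if n = 1 then (2 : ℂ) • X 1 else 0 := by
  rcases hn.eq_or_lt with rfl | hn
  · rfl
  · obtain ⟨k, rfl⟩ := exists_pnat_of_pos hn
    rw [alpha_coe, pderiv_mul]
    rcases eq_or_ne k 1 with rfl | hne
    · rw [pderiv_X_self, if_pos (by simp), smul_eq_C_mul, smul_eq_C_mul]
      simp only [PNat.one_coe, Nat.cast_one, C_1, map_ofNat]
      ring
    · rw [pderiv_X_of_ne hne.symm, if_neg]
      · simp
      · exact fun h => hne (PNat.coe_injective (by exact_mod_cast h))

theorem nthProd_X_one_sq_X {n : ℤ} (hn : 0 ≤ n) (i : ℕ+) :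
    nthProd n (X 1 * X 1) (X i) = alpha (n - i - 1) (C (2 * (i : ℂ))) := by
  have hi := i.pos
  have e1 : ∑ᶠ j : ℕ, alpha (-(j : ℤ) - 1) (alpha (n + j) (X i)) =
      alpha (n - i - 1) (C (i : ℂ)) := by
    rcases lt_or_ge (i : ℤ) n with h | h
    · rw [alpha_C_of_nonneg (by omega)]
      refine (finsum_congr fun j => ?_).trans finsum_zero
      rw [alpha_X_of_nonneg (by omega), if_neg (by omega), map_zero]
    · rw [finsum_eq_single _ ((i : ℤ) - n).toNat fun j hj => by
        rw [alpha_X_of_nonneg (by omega), if_neg (by omega), map_zero]]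
      rw [alpha_X_of_nonneg (by omega), if_pos (by omega)]
      congr 2; omega
  have e2 : ∑ᶠ j : ℕ, alpha (n - j - 1) (alpha j (X i)) = alpha (n - i - 1) (C (i : ℂ)) := by
    rw [finsum_eq_single _ (i : ℕ) fun j hj => by
        rw [alpha_X_of_nonneg (by omega), if_neg (by omega), map_zero]]
    rw [alpha_X_of_nonneg (by omega), if_pos rfl]
  rw [nthProd_X_one_sq, e1, e2, ← map_add, ← C_add, two_mul]

theorem nthProd_X_one_sq_X_one_sq {n : ℤ} (hn : 2 ≤ n) :
    nthProd n (X 1 * X 1) (X 1 * X 1) = alpha (n - 2) ((2 : ℂ) • X 1) := by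
  rw [nthProd_X_one_sq, (finsum_congr fun j => ?_).trans finsum_zero, zero_add,
    finsum_eq_single _ 1 fun j hj => ?_]
  · rw [alpha_X_one_sq_of_nonneg (by omega), if_pos (by omega)]
    congr 2
    push_cast; ring
  · rw [alpha_X_one_sq_of_nonneg (by omega), if_neg (by omega), map_zero]
  · rw [alpha_X_one_sq_of_nonneg (by omega), if_neg (by omega), map_zero]

theorem C_mem_degreeLE (a : ℂ) : C a ∈ degreeLE 0 := fun d hd => by
  rw [coeff_C, if_neg]
  rintro rfl
  simp at hd

theorem X_mem_degreeLE (i : ℕ+) : (X i : Fock) ∈ degreeLE 1 := by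
  have := X_mul_mem_degreeLE i (C_mem_degreeLE 1)
  rwa [C_1, mul_one] at this

theorem coeff_zero_alpha {n : ℤ} (hn : n < 0) (u : Fock) : coeff 0 (alpha n u) = 0 := by
  obtain ⟨k, hk⟩ := exists_pnat_of_pos (neg_pos.mpr hn)
  obtain rfl : n = -(k : ℤ) := by omega
  rw [alpha_neg, coeff_X_mul', if_neg (by simp)]

/-- Each summand is either zero because of α₀ or ends with a multiplication by a variable. -/
theorem coeff_zero_nthProd_one_X_one_sq (u : Fock) : coeff 0 (nthProd 1 (X 1 * X 1) u) = 0 := by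
  have h : ∀ f : ℕ → Fock, (∀ j, coeff 0 (f j) = 0) → coeff 0 (∑ᶠ j, f j) = 0 := fun f h0 =>
    finsum_induction (fun p : Fock => coeff 0 p = 0) (coeff_zero 0)
      (fun p q hp hq => by rw [coeff_add, hp, hq, add_zero]) h0
  rw [nthProd_X_one_sq, coeff_add, h _ fun j => coeff_zero_alpha (by omega) _,
    h _ fun j => ?_, add_zero]
  rcases Nat.eq_zero_or_pos j with rfl | hj
  · rw [Nat.cast_zero, alpha_zero, LinearMap.zero_apply, map_zero, coeff_zero]
  · exact coeff_zero_alpha (by omega) _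

/-! ### Classification of Virasoro vectors -/

/-- The vectors `(x₁ + c)² / 2 + t x₂`. -/
noncomputable def virasoroVec (c t : ℂ) : Fock :=
  C (1 / 2) * ((X 1 + C c) * (X 1 + C c)) + C t * X 2

theorem coeff_single_two_alpha_C (n : ℤ) (a : ℂ) :
    coeff (Finsupp.single 2 1) (alpha n (C a)) = if n = -2 then a else 0 := by
  rcases lt_or_ge n 0 with hn | hn
  · obtain ⟨k, hk⟩ := exists_pnat_of_pos (neg_pos.mpr hn)
    obtain rfl : n = -(k : ℤ) := by omega
    rw [alpha_neg, mul_comm, coeff_C_mul, coeff_X]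
    have : -(k : ℤ) = -2 ↔ k = 2 := by
      rw [neg_inj, ← PNat.coe_inj]; exact Int.ofNat_inj (n := 2)
    simp only [this, Finsupp.single_left_inj one_ne_zero, mul_ite, mul_one, mul_zero]
  · rw [alpha_C_of_nonneg hn, if_neg (by omega), coeff_zero]

/-- Write v = x₁²/2 + a₀ + ∑ aᵢxᵢ. The coefficient of x₂ in v₍ₖ₋₁₎v is k aₖ for k ≥ 3, so aₖ = 0.
The constant term of v₍₁₎v = 2v gives a₁² = 2a₀, which completes the square. -/
theorem IsVirasoroVector.exists_eq {v : Fock} {c : ℂ} (hv : IsVirasoroVector v c) :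
    ∃ a t : ℂ, v = virasoroVec a t := by
  have hdeg := hv.sub_mem_degreeLE_one
  set f := v - C (1 / 2) * (X 1 * X 1) with hf
  -- The indices 1 and 2 are adjoined so that their terms can be split off even when they vanish.
  set s := f.vars ∪ {1, 2} with hs
  have hfs := eq_sum_of_mem_degreeLE_one hdeg (s := s) Finset.subset_union_left
  set a : ℕ+ → ℂ := fun i => coeff (Finsupp.single i 1) f with ha
  set a₀ := coeff 0 f with ha₀
  have hsq : (X 1 * X 1 : Fock) = monomial (Finsupp.single 1 2) 1 := by
    rw [← pow_two, X_pow_eq_monomial]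
  have hvf : v = C (1 / 2) * (X 1 * X 1) + f := by rw [hf]; ring
  have hv1 : v = (1 / 2 : ℂ) • (X 1 * X 1) + (C a₀ + ∑ i ∈ s, a i • X i) := by
    rw [← hfs, smul_eq_C_mul, ← hvf]
  have hcoeff : ∀ d : ℕ+ →₀ ℕ, d ≠ Finsupp.single 1 2 → coeff d v = coeff d f := fun d hd => by
    rw [hvf, coeff_add, coeff_C_mul, hsq, coeff_monomial, if_neg (Ne.symm hd), mul_zero, zero_add]
  have hmode : ∀ n : ℤ, 0 ≤ n → ∀ u, nthProd n v u = (1 / 2 : ℂ) • nthProd n (X 1 * X 1) u +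
      ∑ i ∈ s, a i • (derivField i).mode n u := fun n hn u => by
    conv_lhs => rw [hv1]
    rw [map_add, map_add, map_smul, map_sum, LinearMap.add_apply, LinearMap.add_apply,
      nthProd_C, if_neg (by omega), zero_add, LinearMap.smul_apply, LinearMap.sum_apply]
    simp only [map_smul, LinearMap.smul_apply, nthProd_X]
  have hdeg0 : ∀ p ∈ degreeLE 0, coeff (Finsupp.single 2 1) p = 0 := fun p hp =>
    hp _ (by rw [Finsupp.degree_single]; norm_num)
  have hx2 : ∀ k : ℕ+, k ∈ s → k ≠ 1 ∧ k ≠ 2 → a k = 0 := by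
    rintro k hks ⟨hk1, hk2⟩
    have hk' : 2 < (k : ℕ) := by
      have h1 : (k : ℕ) ≠ 1 := fun h => hk1 (PNat.coe_injective h)
      have h2 : (k : ℕ) ≠ 2 := fun h => hk2 (PNat.coe_injective h)
      have := k.pos
      omega
    have hzero : coeff (Finsupp.single 2 1) (nthProd ((k : ℤ) - 1) v v) = 0 := by
      rcases lt_or_ge (k : ℤ) 5 with h5 | h5
      · rcases (show (k : ℤ) - 1 = 2 ∨ (k : ℤ) - 1 = 3 by omega) with e | e
        · rw [e, hv.prod_two, coeff_zero]
        · rw [e, hv.prod_three]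
          exact hdeg0 _ (Submodule.smul_mem _ _ (C_mem_degreeLE 1))
      · rw [hv.prod_ge_four _ (by omega), coeff_zero]
    -- This coefficient is a multiple of that of some xⱼx₂ in v, but the quadratic part of v is
    -- x₁²/2.
    have h1 : ∀ i : ℕ+, coeff (Finsupp.single 2 1) ((derivField i).mode ((k : ℤ) - 1) v) = 0 := by
      intro i
      rcases lt_or_ge ((k : ℤ) - 1) i with h | h
      · rw [derivField_mode_of_lt i (by omega) h, LinearMap.zero_apply, coeff_zero]
      · obtain ⟨j, hj⟩ := exists_pnat_of_pos (show 0 < (k : ℤ) - 1 - i + 1 by omega)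
        rw [derivField_mode, hj, LinearMap.smul_apply, alpha_coe, ← Int.cast_smul_eq_zsmul ℂ,
          coeff_smul, coeff_smul, coeff_pderiv, hcoeff, hdeg]
        · simp
        · rw [map_add, Finsupp.degree_single, Finsupp.degree_single]; norm_num
        · intro h
          have := DFunLike.congr_fun h 2
          rw [Finsupp.add_apply, Finsupp.single_eq_same,
            Finsupp.single_eq_of_ne (show (2 : ℕ+) ≠ 1 by decide)] at this
          omega
    have h2 : coeff (Finsupp.single 2 1) (nthProd ((k : ℤ) - 1) (X 1 * X 1) v) = 2 * k * a k := by
      conv_lhs => rw [hv1]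
      rw [map_add, map_add, map_smul, map_sum, coeff_add, coeff_add,
        nthProd_X_one_sq_X_one_sq (by omega), coeff_sum, Finset.sum_eq_single_of_mem k hks]
      · rw [hdeg0 _ (Submodule.smul_mem _ _ (degreeLE_mono (by norm_num)
          (alpha_mem_degreeLE_of_nonneg (by omega) (Submodule.smul_mem _ _ (X_mem_degreeLE 1))))),
          hdeg0 _ (degreeLE_mono (by norm_num) (nthProd_mem_degreeLE (by omega)
            (X_mul_mem_degreeLE 1 (X_mem_degreeLE 1)) (C_mem_degreeLE a₀))),
          map_smul, coeff_smul, nthProd_X_one_sq_X (by omega), coeff_single_two_alpha_C,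
          if_pos (by ring), smul_eq_mul]
        ring
      · intro i _ hi
        rw [map_smul, coeff_smul, nthProd_X_one_sq_X (by omega), coeff_single_two_alpha_C, if_neg,
          smul_zero]
        intro h
        exact hi (PNat.coe_injective (by omega))
    rw [hmode _ (by omega), coeff_add, coeff_smul, coeff_sum, h2, Finset.sum_eq_zero, add_zero,
      smul_eq_mul] at hzero
    · have : (k : ℂ) ≠ 0 := by simp
      have h3 : (k : ℂ) * a k = 0 := by linear_combination hzero
      exact (mul_eq_zero.mp h3).resolve_left this
    · intro i _
      rw [coeff_smul, h1, smul_zero]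
  have hconst : a 1 * a 1 = 2 * a₀ := by
    have h := congrArg (coeff 0) hv.prod_one
    rw [hmode _ zero_le_one, coeff_add, coeff_smul, coeff_zero_nthProd_one_X_one_sq, smul_zero,
      zero_add, coeff_sum, Finset.sum_eq_single_of_mem 1 (by simp [hs]), coeff_smul,
      derivField_one_mode, coeff_smul, hcoeff 0 (Ne.symm (by simp)), ← ha₀] at h
    · have e := alpha_coe 1 v
      rw [PNat.one_coe, Nat.cast_one, Nat.cast_one, one_smul] at e
      rw [e, coeff_pderiv, zero_add, hcoeff _ fun h => by simpa using DFunLike.congr_fun h 1] at h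
      simpa [ha] using h
    · intro i _ hi
      have h1 : (i : ℕ) ≠ 1 := fun h => hi (PNat.coe_injective h)
      rw [derivField_mode_of_lt i zero_le_one (by have := i.pos; omega), LinearMap.zero_apply,
        smul_zero, coeff_zero]
  refine ⟨a 1, a 2, ?_⟩
  have hsum : ∑ i ∈ s, a i • (X i : Fock) = a 1 • X 1 + a 2 • X 2 := by
    rw [← Finset.sum_pair (show (1 : ℕ+) ≠ 2 by decide) (f := fun i => a i • (X i : Fock))]
    refine (Finset.sum_subset Finset.subset_union_right fun i hi hi' => ?_).symm
    rw [hx2 i hi (by simpa using hi'), zero_smul]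
  have ea : a₀ = 1 / 2 * (a 1 * a 1) := by rw [hconst]; ring
  rw [hv1, hsum, ea, virasoroVec]
  simp only [smul_eq_C_mul, C_mul]
  have : (C (1 / 2) * 2 : Fock) = 1 := by
    rw [← map_ofNat C 2, ← C_mul]; norm_num
  linear_combination (-(X 1 * C (a 1))) * this

/-! ### The affine automorphisms -/

/-- The algebra endomorphism `x₁ ↦ ε x₁ + c`, `xᵢ ↦ ε xᵢ` (`i > 1`) of the Fock space. -/
noncomputable def affineHom (ε c : ℂ) : Fock →ₐ[ℂ] Fock :=
  aeval fun i => ε • X i + if i = 1 then C c else 0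

theorem affineHom_X (ε c : ℂ) (i : ℕ+) :
    affineHom ε c (X i) = ε • X i + if i = 1 then C c else 0 := aeval_X _ _

theorem affineHom_comp (ε c ε' c' : ℂ) (u : Fock) :
    affineHom ε c (affineHom ε' c' u) = affineHom (ε * ε') (ε' * c + c') u := by
  have h : (affineHom ε c).comp (affineHom ε' c') = affineHom (ε * ε') (ε' * c + c') := by
    refine algHom_ext fun i => ?_
    have hC : ∀ a, affineHom ε c (C a) = C a := fun a => aeval_C _ _
    rw [AlgHom.comp_apply, affineHom_X, affineHom_X, map_add, map_smul, affineHom_X,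
      apply_ite (affineHom ε c), hC, map_zero]
    split_ifs <;> simp only [smul_eq_C_mul, map_add, map_mul] <;> ring
  exact DFunLike.congr_fun h u

theorem affineHom_one_zero (u : Fock) : affineHom 1 0 u = u := by
  have h : affineHom 1 0 = AlgHom.id ℂ Fock := by
    refine algHom_ext fun i => ?_
    rw [affineHom_X]; simp
  rw [h]; rfl

/-- The map `affineHom` as a linear equivalence, for `ε = ±1`. -/
noncomputable def affineEquiv (ε c : ℂ) (h : ε * ε = 1) : Fock ≃ₗ[ℂ] Fock :=
  LinearEquiv.ofLinearMap (affineHom ε c).toLinearMap (affineHom ε (-(ε * c))).toLinearMap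
    (LinearMap.ext fun u => by
      have e : ε * c + -(ε * c) = 0 := by ring
      change affineHom ε c (affineHom ε (-(ε * c)) u) = u
      rw [affineHom_comp, h, e, affineHom_one_zero])
    (LinearMap.ext fun u => by
      have e : ε * -(ε * c) + c = 0 := by linear_combination -c * h
      change affineHom ε (-(ε * c)) (affineHom ε c u) = u
      rw [affineHom_comp, h, e, affineHom_one_zero])

theorem affineEquiv_apply (ε c : ℂ) (h : ε * ε = 1) (u : Fock) :
    affineEquiv ε c h u = affineHom ε c u := rfl

section Intertwining

variable {ε c : ℂ}

theorem pderiv_affineHom (k : ℕ+) (u : Fock) :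
    pderiv k (affineHom ε c u) = ε • affineHom ε c (pderiv k u) := by
  induction u using MvPolynomial.induction_on with
  | C a =>
    have hC : affineHom ε c (C a) = C a := aeval_C _ _
    rw [hC, pderiv_C, map_zero, smul_zero]
  | add p q hp hq => simp only [map_add, hp, hq, smul_add]
  | mul_X p i hp =>
    have hi : pderiv k (if i = 1 then C c else 0 : Fock) = 0 := by
      split_ifs <;> simp
    rw [map_mul, pderiv_mul, pderiv_mul, map_add, map_mul, map_mul, hp, affineHom_X, map_add,
      Derivation.map_smul, hi, add_zero]
    rcases eq_or_ne i k with rfl | hne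
    · rw [pderiv_X_self, map_one, smul_add, smul_mul_assoc, mul_smul_comm]
    · rw [pderiv_X_of_ne hne, map_zero, smul_mul_assoc]
      simp only [mul_zero, smul_zero, add_zero]

/-- Creation operators scale by ε and annihilation operators by its inverse; these agree because ε²
= 1. The shift by c affects only α₋₁, multiplication by x₁. -/
theorem affineHom_alpha (h : ε * ε = 1) (n : ℤ) (u : Fock) : affineHom ε c (alpha n u) =
    ε • alpha n (affineHom ε c u) + if n = -1 then c • affineHom ε c u else 0 := by
  rcases lt_trichotomy n 0 with hn | rfl | hn
  · obtain ⟨k, hk⟩ := exists_pnat_of_pos (neg_pos.mpr hn)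
    obtain rfl : n = -(k : ℤ) := by omega
    have e : -(k : ℤ) = -1 ↔ k = 1 := by
      rw [neg_inj, ← PNat.coe_inj]; exact Int.ofNat_inj (n := 1)
    simp only [e]
    rw [alpha_neg, alpha_neg, map_mul, affineHom_X, add_mul, smul_mul_assoc, ite_mul, zero_mul,
      smul_eq_C_mul (affineHom ε c u)]
  · rw [if_neg (by norm_num), alpha_zero]
    simp
  · obtain ⟨k, rfl⟩ := exists_pnat_of_pos hn
    rw [if_neg (by omega), add_zero, alpha_coe, alpha_coe, map_smul, pderiv_affineHom,
      smul_comm ε, smul_smul ε, h, one_smul]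

theorem affineHom_nthProd_X (h : ε * ε = 1) (n : ℤ) (i : ℕ+) (u : Fock) :
    affineHom ε c (nthProd n (X i) u) = nthProd n (affineHom ε c (X i)) (affineHom ε c u) := by
  have hi := i.pos
  rw [affineHom_X, map_add, map_smul, LinearMap.add_apply, LinearMap.smul_apply, nthProd_X,
    derivField_mode, LinearMap.smul_apply, LinearMap.smul_apply, map_zsmul, affineHom_alpha h,
    smul_add, smul_comm ε]
  congr 1
  rcases eq_or_ne i 1 with rfl | hne
  · rw [if_pos rfl, nthProd_C]
    simp
  · have h1 : (i : ℕ) ≠ 1 := fun h => hne (PNat.coe_injective h)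
    rw [if_neg hne, map_zero, LinearMap.zero_apply]
    split_ifs with hn
    -- Derivatives annihilate the constant shift of α(z): the coefficient in front of α₋₁ is
    -- binom(0, i - 1) = 0 for i > 1.
    · rw [show (i : ℤ) - n - 2 = 0 by omega, Ring.choose_zero_pos ℤ (by omega), zero_smul]
    · rw [smul_zero]

theorem normalOrder_intertwine {M : Type*} [AddCommGroup M] [Module ℂ M] (σ : M ≃ₗ[ℂ] M)
    {A A' B B' : FormalField M} (hA : ∀ n u, σ (A.mode n u) = A'.mode n (σ u))
    (hB : ∀ n u, σ (B.mode n u) = B'.mode n (σ u)) (n : ℤ) (u : M) :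
    σ ((A.normalOrder B).mode n u) = (A'.normalOrder B').mode n (σ u) := by
  rw [normalOrder_mode, normalOrder_mode]
  refine (σ.toAddEquiv.toAddMonoidHom.map_finsum (normalOrder_mode_finite A B n u)).trans
    (finsum_congr fun j => ?_)
  change σ _ = _
  rw [map_add, hA, hB, hB, hA]

theorem prod_map_X_eq_monomial (l : List ℕ+) :
    (l.map X).prod = (monomial (Multiset.toFinsupp (l : Multiset ℕ+)) 1 : Fock) := by
  induction l with
  | nil => simp
  | cons i l ih =>
    rw [List.map_cons, List.prod_cons, ih, ← Multiset.cons_coe, ← Multiset.singleton_add,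
      Multiset.toFinsupp_add, Multiset.toFinsupp_singleton, X, monomial_mul, one_mul]

theorem affineHom_prod_map_X (l : List ℕ+) (hl : ∀ i ∈ l, i ≠ 1) :
    affineHom ε c (l.map X).prod = ε ^ l.length • (l.map X).prod := by
  induction l with
  | nil => simp
  | cons i l ih =>
    rw [List.map_cons, List.prod_cons, map_mul, ih fun k hk => hl k (List.mem_cons_of_mem _ hk),
      affineHom_X, if_neg (hl i List.mem_cons_self), add_zero, smul_mul_smul_comm, List.length_cons,
      pow_succ']

/-- For i = 1 the factor εx₁ + c may multiply any polynomial, by `nthProd_X_one_mul`. For i > 1 no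
x₁ occurs in the word, which is therefore merely scaled and stays sorted. -/
theorem normalOrder_affineHom (i : ℕ+) (l : List ℕ+) (hl : ∀ k ∈ l, i ≤ k) (n : ℤ) :
    ((vertexField (affineHom ε c (X i))).normalOrder
      (vertexField (affineHom ε c (l.map X).prod))).mode n =
        nthProd n (affineHom ε c (X i) * affineHom ε c (l.map X).prod) := by
  rw [affineHom_X]
  rcases eq_or_ne i 1 with rfl | hne
  · rw [if_pos rfl]
    generalize affineHom ε c (l.map X).prod = b
    rw [add_mul, map_add, smul_mul_assoc, map_smul, nthProd_X_one_mul, ← smul_eq_C_mul, map_smul,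
      normalOrder_mode_add_left _ (vertexField (ε • X 1)) (vertexField (C c)) _
        (fun k => by simp only [vertexField_mode, map_add]),
      normalOrder_mode_smul_left (vertexField (ε • X 1)) alphaField _ ε
        (fun k => by rw [vertexField_mode, map_smul, nthProd_X_one]; rfl),
      normalOrder_mode_smul_left (vertexField (C c)) FormalField.one _ c
        (fun k => ?_), one_normalOrder, vertexField_mode]
    refine LinearMap.ext fun u => ?_
    rw [vertexField_mode, nthProd_C, LinearMap.smul_apply, one_mode, smul_ite, smul_zero]
  · rw [if_neg hne, add_zero, affineHom_prod_map_X l fun k hk hk1 =>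
      hne (le_antisymm (hk1 ▸ hl k hk) one_le), smul_mul_smul_comm, map_smul,
      prod_map_X_eq_monomial, nthProd_X_mul_monomial _ _ _ fun k hk => hl k (by simpa using hk),
      normalOrder_mode_smul_left _ (derivField i) _ ε
        (fun k => by rw [vertexField_mode, map_smul, nthProd_X]),
      normalOrder_mode_smul_right _ _ (vertexField (monomial _ 1)) (ε ^ l.length)
        (fun k => by rw [vertexField_mode, vertexField_mode, map_smul]), smul_smul]

theorem affineHom_wordField (h : ε * ε = 1) (l : List ℕ+) (hl : l.Pairwise (· ≤ ·)) (n : ℤ)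
    (u : Fock) : affineHom ε c ((wordField l).mode n u) =
      nthProd n (affineHom ε c (l.map X).prod) (affineHom ε c u) := by
  induction l generalizing n u with
  | nil =>
    change affineHom ε c ((FormalField.one : FormalField Fock).mode n u) = _
    rw [one_mode, List.map_nil, List.prod_nil, map_one, nthProd_one, apply_ite (affineHom ε c),
      map_zero]
  | cons i l ih =>
    rw [List.pairwise_cons] at hl
    rw [List.map_cons, List.prod_cons, map_mul, ← normalOrder_affineHom i l hl.1, wordField_cons]
    exact normalOrder_intertwine (affineEquiv ε c h) (A' := vertexField (affineHom ε c (X i)))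
      (B' := vertexField (affineHom ε c (l.map X).prod))
      (fun k w => by
        rw [affineEquiv_apply, affineEquiv_apply, vertexField_mode, ← affineHom_nthProd_X h,
          nthProd_X])
      (fun k w => ih hl.2 k w) n u

theorem isAutomorphism_affineEquiv (h : ε * ε = 1) : IsAutomorphism (affineEquiv ε c h) := by
  intro n a b
  rw [affineEquiv_apply, affineEquiv_apply, affineEquiv_apply]
  induction a using MvPolynomial.induction_on' with
  | monomial d r =>
    rw [nthProd_monomial, LinearMap.smul_apply, map_smul,
      affineHom_wordField h _ (Multiset.pairwise_sort _ _), prod_map_X_sort_toMultiset,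
      ← LinearMap.smul_apply, ← map_smul, ← map_smul, smul_monomial, smul_eq_mul, mul_one]
  | add p q hp hq => simp only [map_add, LinearMap.add_apply, hp, hq]

end Intertwining

theorem IsAutomorphism.symm {σ : Fock ≃ₗ[ℂ] Fock} (hσ : IsAutomorphism σ) :
    IsAutomorphism σ.symm := fun n a b => by
  rw [LinearEquiv.symm_apply_eq, hσ, LinearEquiv.apply_symm_apply, LinearEquiv.apply_symm_apply]

theorem IsAutomorphism.trans {σ τ : Fock ≃ₗ[ℂ] Fock} (hσ : IsAutomorphism σ)
    (hτ : IsAutomorphism τ) : IsAutomorphism (σ.trans τ) := fun n a b => by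
  simp only [LinearEquiv.trans_apply, hσ n, hτ n]

theorem IsAutomorphism.map_one {σ : Fock ≃ₗ[ℂ] Fock} (hσ : IsAutomorphism σ) : σ 1 = 1 := by
  have h := hσ (-1) 1 (σ.symm 1)
  rw [nthProd_one, if_pos rfl, LinearEquiv.apply_symm_apply, nthProd_neg_one_one] at h
  exact h.symm

theorem affineHom_virasoroVec (a c t : ℂ) :
    affineHom 1 c (virasoroVec a t) = virasoroVec (c + a) t := by
  have hC : ∀ a, affineHom 1 c (C a) = C a := fun a => aeval_C _ _
  simp only [virasoroVec, map_add, map_mul, affineHom_X, hC, one_smul, if_pos,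
    if_neg (show (2 : ℕ+) ≠ 1 by decide), add_zero, add_assoc]

theorem affineHom_neg_virasoroVec (c : ℂ) :
    affineHom (-1) (-(2 * c)) (virasoroVec c 0) = virasoroVec c 0 := by
  have hC : ∀ a, affineHom (-1) (-(2 * c)) (C a) = C a := fun a => aeval_C _ _
  simp only [virasoroVec, map_add, map_mul, affineHom_X, hC, neg_smul, one_smul, if_pos, C_neg, C_0,
    zero_mul, add_zero, map_ofNat C 2]
  ring

/-! ### L₋₁, L₀ and L₁ as derivations -/

theorem finsum_nat_add_eq {M : Type*} [AddCommMonoid M] {f : ℕ → M} (n : ℕ)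
    (hf : ∀ j < n, f j = 0) : ∑ᶠ j, f (j + n) = ∑ᶠ j, f j := by
  rw [← finsum_mem_range (f := f) (add_left_injective n)]
  refine finsum_congr fun j => ?_
  classical
  by_cases hj : j ∈ Set.range (· + n)
  · exact finsum_eq_if.trans (if_pos hj)
  · refine (finsum_eq_if.trans (if_neg hj)).trans (hf j ?_).symm
    by_contra h
    exact hj ⟨j - n, Nat.sub_add_cancel (not_lt.mp h)⟩

/-- The annihilation sum is the creation sum shifted by n: its first n terms all contain α₀ = 0. For
n = 3 the term α₁α₁ would survive. -/
theorem nthProd_X_one_sq_of_le_two {n : ℕ} (hn : n ≤ 2) (u : Fock) :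
    nthProd n (X 1 * X 1) u = (2 : ℂ) • ∑ᶠ j : ℕ, alpha (-(j : ℤ) - 1) (alpha (n + j) u) := by
  rw [nthProd_X_one_sq, two_smul]
  congr 1
  rw [← finsum_nat_add_eq n fun j hj => ?_]
  · refine finsum_congr fun j => ?_
    rw [show (n : ℤ) - ((j + n : ℕ) : ℤ) - 1 = -(j : ℤ) - 1 by push_cast; ring,
      show ((j + n : ℕ) : ℤ) = n + j by push_cast; ring]
  · rcases Nat.eq_zero_or_pos j with rfl | hj0
    · rw [Nat.cast_zero, alpha_zero, LinearMap.zero_apply, map_zero]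
    · rw [show (n : ℤ) - j - 1 = 0 by omega, alpha_zero, LinearMap.zero_apply]

theorem virasoroVec_zero (t : ℂ) :
    virasoroVec 0 t = (1 / 2 : ℂ) • (X 1 * X 1) + t • X 2 := by
  rw [virasoroVec, C_0, add_zero, smul_eq_C_mul, smul_eq_C_mul]

theorem derivField_two_mode (n : ℤ) : (derivField 2).mode n = (-(n : ℂ)) • alpha (n - 1) := by
  have h : ((2 : ℕ+) : ℤ) = 2 := rfl
  have h' : ((2 : ℕ+) : ℕ) - 1 = 1 := rfl
  rw [derivField_mode, h, h', Ring.choose_one_right, ← Int.cast_smul_eq_zsmul ℂ]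
  congr 1
  · push_cast; ring
  · congr 1; ring

theorem nthProd_virasoroVec_zero {n : ℕ} (hn : n ≤ 2) (t : ℂ) (u : Fock) :
    nthProd n (virasoroVec 0 t) u = ∑ᶠ j : ℕ, alpha (-(j : ℤ) - 1) (alpha (n + j) u) +
      (-(n * t)) • alpha (n - 1) u := by
  rw [virasoroVec_zero, map_add, LinearMap.add_apply, map_smul, map_smul, LinearMap.smul_apply,
    LinearMap.smul_apply, nthProd_X_one_sq_of_le_two hn, smul_smul, nthProd_X, derivField_two_mode,
    LinearMap.smul_apply, smul_smul]
  congr 2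
  · norm_num
  · push_cast; ring

theorem alpha_mul_of_nonneg {n : ℤ} (hn : 0 ≤ n) (f g : Fock) :
    alpha n (f * g) = f * alpha n g + g * alpha n f := by
  rcases hn.eq_or_lt with rfl | hn
  · simp [alpha_zero]
  · obtain ⟨k, rfl⟩ := exists_pnat_of_pos hn
    rw [alpha_coe, alpha_coe, alpha_coe, pderiv_mul, mul_smul_comm, mul_smul_comm, ← smul_add]
    ring_nf

theorem alpha_mul_of_neg {n : ℤ} (hn : n < 0) (f g : Fock) :
    alpha n (f * g) = f * alpha n g := by
  obtain ⟨k, hk⟩ := exists_pnat_of_pos (neg_pos.mpr hn)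
  obtain rfl : n = -(k : ℤ) := by omega
  rw [alpha_neg, alpha_neg]
  ring

/-- Each summand is one derivative followed by a multiplication, hence a derivation. The linear term
contributes n t αₙ₋₁ up to sign, and its only multiplication operator, at n = 0, has coefficient
zero. -/
theorem nthProd_virasoroVec_zero_mul {n : ℕ} (hn : n ≤ 2) (t : ℂ) (f g : Fock) :
    nthProd n (virasoroVec 0 t) (f * g) =
      f * nthProd n (virasoroVec 0 t) g + g * nthProd n (virasoroVec 0 t) f := by
  have h1 : (n : ℂ) = 0 ∨ 0 ≤ (n : ℤ) - 1 := by
    rcases Nat.eq_zero_or_pos n with rfl | h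
    · exact Or.inl Nat.cast_zero
    · exact Or.inr (by omega)
  have h2 : ∀ f g : Fock, (-(n * t)) • alpha (n - 1) (f * g) =
      f * (-(n * t)) • alpha (n - 1) g + g * (-(n * t)) • alpha (n - 1) f := fun f g => by
    rcases h1 with h | h
    · simp [h]
    · rw [alpha_mul_of_nonneg h, mul_smul_comm, mul_smul_comm, smul_add]
  have hfin : ∀ u, (Function.support fun j : ℕ => alpha (-(j : ℤ) - 1) (alpha (n + j) u)).Finite :=
    fun u => creation_support_finite alphaField alphaField n u
  have hmul : ∀ f g : Fock, f * ∑ᶠ j : ℕ, alpha (-(j : ℤ) - 1) (alpha (n + j) g) =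
      ∑ᶠ j : ℕ, f * alpha (-(j : ℤ) - 1) (alpha (n + j) g) := fun f g => mul_finsum' _ _ (hfin g)
  have hfin' : ∀ f g : Fock, (Function.support fun j : ℕ =>
      f * alpha (-(j : ℤ) - 1) (alpha (n + j) g)).Finite := fun f g =>
    (hfin g).subset fun j hj h => hj (by simp only [h, mul_zero])
  have h3 : ∑ᶠ j : ℕ, alpha (-(j : ℤ) - 1) (alpha (n + j) (f * g)) =
      f * ∑ᶠ j : ℕ, alpha (-(j : ℤ) - 1) (alpha (n + j) g) +
        g * ∑ᶠ j : ℕ, alpha (-(j : ℤ) - 1) (alpha (n + j) f) := by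
    rw [hmul, hmul, ← finsum_add_distrib (hfin' f g) (hfin' g f)]
    refine finsum_congr fun j => ?_
    rw [alpha_mul_of_nonneg (by omega), map_add, alpha_mul_of_neg (by omega),
      alpha_mul_of_neg (by omega)]
  rw [nthProd_virasoroVec_zero hn, nthProd_virasoroVec_zero hn, nthProd_virasoroVec_zero hn, h2, h3]
  ring

/-- For `n = 0, 1, 2`, the operator `Lₙ₋₁` of the conformal vector `x₁² / 2 + t x₂` is a
derivation of the polynomial ring. -/
noncomputable def virasoroDeriv (t : ℂ) (n : ℕ) (hn : n ≤ 2) : Derivation ℂ Fock Fock :=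
  Derivation.mk' (nthProd n (virasoroVec 0 t)) (nthProd_virasoroVec_zero_mul hn t)

theorem virasoroDeriv_apply (t : ℂ) {n : ℕ} (hn : n ≤ 2) (u : Fock) :
    virasoroDeriv t n hn u = nthProd n (virasoroVec 0 t) u := rfl

theorem virasoroDeriv_X (t : ℂ) {n : ℕ} (hn : n ≤ 2) (i : ℕ+) :
    virasoroDeriv t n hn (X i) = alpha (n - i - 1) (C (i : ℂ)) +
      if n = 2 ∧ i = 1 then C (-(2 * t)) else 0 := by
  rw [virasoroDeriv_apply, nthProd_virasoroVec_zero hn]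
  congr 1
  · rcases lt_or_ge (i : ℤ) n with h | h
    · rw [alpha_C_of_nonneg (by omega)]
      refine (finsum_congr fun j => ?_).trans finsum_zero
      rw [alpha_X_of_nonneg (by omega), if_neg (by omega), map_zero]
    · rw [finsum_eq_single _ ((i : ℤ) - n).toNat fun j hj => by
        rw [alpha_X_of_nonneg (by omega), if_neg (by omega), map_zero]]
      rw [alpha_X_of_nonneg (by omega), if_pos (by omega)]
      congr 2; omega
  · interval_cases n
    · simp
    · simp [alpha_zero]
    · rw [show ((2 : ℕ) : ℤ) - 1 = 1 by norm_num, alpha_X_of_nonneg zero_le_one]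
      have e : (1 : ℤ) = i ↔ i = 1 := by
        rw [← PNat.coe_inj, PNat.one_coe]; omega
      simp only [e, true_and, smul_ite, smul_zero]
      split_ifs with h
      · rw [h, smul_eq_C_mul, ← C_mul]; simp
      · rfl

theorem translationDeriv_X (t : ℂ) (i : ℕ+) :
    virasoroDeriv t 0 (by norm_num) (X i) = (i : ℂ) • X (i + 1) := by
  rw [virasoroDeriv_X, if_neg (by simp), add_zero,
    show ((0 : ℕ) : ℤ) - i - 1 = -((i + 1 : ℕ+) : ℤ) by push_cast; ring, alpha_neg, mul_comm,
    smul_eq_C_mul]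

theorem weightDeriv_X (t : ℂ) (i : ℕ+) :
    virasoroDeriv t 1 (by norm_num) (X i) = (i : ℂ) • X i := by
  rw [virasoroDeriv_X, if_neg (by simp), add_zero,
    show ((1 : ℕ) : ℤ) - i - 1 = -(i : ℤ) by push_cast; ring, alpha_neg, mul_comm, smul_eq_C_mul]

theorem loweringDeriv_X_one (t : ℂ) :
    virasoroDeriv t 2 le_rfl (X 1) = C (-(2 * t)) := by
  rw [virasoroDeriv_X, if_pos ⟨rfl, rfl⟩]
  simp [alpha_zero]

theorem loweringDeriv_X_add_one (t : ℂ) (i : ℕ+) :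
    virasoroDeriv t 2 le_rfl (X (i + 1)) = ((i : ℂ) + 1) • X i := by
  have h : i + 1 ≠ 1 := fun h => by
    have := congrArg PNat.val h
    simp at this
  rw [virasoroDeriv_X, if_neg fun h' => h h'.2, add_zero,
    show ((2 : ℕ) : ℤ) - ((i + 1 : ℕ+) : ℤ) - 1 = -(i : ℤ) by push_cast; ring, alpha_neg, mul_comm,
    smul_eq_C_mul]
  simp

/-! ### The action of sl₂ -/

theorem slTwo_eq (A : SlTwo) :
    A = A.1 0 1 • slE + A.1 0 0 • slH + A.1 1 0 • slF := by
  have htr : A.1 0 0 + A.1 1 1 = 0 := by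
    have h : A.1.trace = 0 := (LinearMap.mem_ker (f := Matrix.traceLinearMap (Fin 2) ℂ ℂ)).mp A.2
    rwa [Matrix.trace_fin_two] at h
  ext i j
  change A.1 i j = A.1 0 1 * slE.1 i j + A.1 0 0 * slH.1 i j + A.1 1 0 * slF.1 i j
  fin_cases i <;> fin_cases j <;> simp [slE, slH, slF]
  linear_combination htr

/-- The representation of `sl₂(ℂ)` given by three operators satisfying the relations of the
standard basis. -/
noncomputable def slTwoHom {M : Type*} [AddCommGroup M] [Module ℂ M] (e h f : Module.End ℂ M)
    (hef : ∀ u, e (f u) - f (e u) = h u) (hhe : ∀ u, h (e u) - e (h u) = (2 : ℂ) • e u)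
    (hhf : ∀ u, h (f u) - f (h u) = -((2 : ℂ) • f u)) :
    SlTwo →ₗ⁅ℂ⁆ Module.End ℂ M where
  toFun A := A.1 0 1 • e + A.1 0 0 • h + A.1 1 0 • f
  map_add' A B := by
    change (A.1 0 1 + B.1 0 1) • e + (A.1 0 0 + B.1 0 0) • h + (A.1 1 0 + B.1 1 0) • f = _
    module
  map_smul' c A := by
    change (c * A.1 0 1) • e + (c * A.1 0 0) • h + (c * A.1 1 0) • f =
      c • (A.1 0 1 • e + A.1 0 0 • h + A.1 1 0 • f)
    module
  map_lie' := by
    intro A B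
    have htr : ∀ A : SlTwo, A.1 1 1 = -A.1 0 0 := fun A => by
      have h : A.1.trace = 0 := (LinearMap.mem_ker (f := Matrix.traceLinearMap (Fin 2) ℂ ℂ)).mp A.2
      rw [Matrix.trace_fin_two] at h
      linear_combination h
    have hb : ∀ i j, (⁅A, B⁆ : SlTwo).1 i j = (A.1 * B.1 - B.1 * A.1) i j := fun i j => rfl
    have hef : ⁅e, f⁆ = h := LinearMap.ext hef
    have hhe : ⁅h, e⁆ = (2 : ℂ) • e := LinearMap.ext hhe
    have hhf : ⁅h, f⁆ = -((2 : ℂ) • f) := LinearMap.ext hhf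
    have heh : ⁅e, h⁆ = -((2 : ℂ) • e) := by rw [← lie_skew, hhe]
    have hfh : ⁅f, h⁆ = (2 : ℂ) • f := by rw [← lie_skew, hhf, neg_neg]
    have hfe : ⁅f, e⁆ = -h := by rw [← lie_skew, hef]
    simp only [hb, Matrix.sub_apply, Matrix.mul_apply, Fin.sum_univ_two, htr, add_lie, lie_add,
      smul_lie, lie_smul, lie_self, hef, hhe, hhf, heh, hfh, hfe]
    module

section Relations

variable (t : ℂ)

theorem lie_loweringDeriv_translationDeriv :
    ⁅virasoroDeriv t 2 le_rfl, virasoroDeriv t 0 (by norm_num)⁆ =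
      (2 : ℂ) • virasoroDeriv t 1 (by norm_num) := by
  refine derivation_ext fun i => ?_
  rw [Derivation.commutator_apply, Derivation.smul_apply, translationDeriv_X, weightDeriv_X,
    Derivation.map_smul, loweringDeriv_X_add_one]
  induction i using PNat.recOn with
  | one => rw [loweringDeriv_X_one, derivation_C, sub_zero]; norm_num
  | succ i _ =>
    rw [loweringDeriv_X_add_one, Derivation.map_smul, translationDeriv_X]
    push_cast
    module

theorem lie_weightDeriv_translationDeriv :
    ⁅virasoroDeriv t 1 (by norm_num), virasoroDeriv t 0 (by norm_num)⁆ =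
      virasoroDeriv t 0 (by norm_num) := by
  refine derivation_ext fun i => ?_
  rw [Derivation.commutator_apply, translationDeriv_X, weightDeriv_X,
    Derivation.map_smul, Derivation.map_smul, weightDeriv_X, translationDeriv_X]
  push_cast
  module

theorem lie_weightDeriv_loweringDeriv :
    ⁅virasoroDeriv t 1 (by norm_num), virasoroDeriv t 2 le_rfl⁆ = -virasoroDeriv t 2 le_rfl := by
  refine derivation_ext fun i => ?_
  rw [Derivation.commutator_apply, Derivation.neg_apply, weightDeriv_X, Derivation.map_smul]
  induction i using PNat.recOn with
  | one => rw [loweringDeriv_X_one, derivation_C]; simp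
  | succ i _ =>
    rw [loweringDeriv_X_add_one, Derivation.map_smul, weightDeriv_X]
    push_cast
    module

end Relations

/-- The translation x₁ ↦ x₁ + c carries the vector with c = 0 to the one with parameter c, so it
intertwines their modes and reduces questions about the action to c = 0. -/
theorem nthProd_virasoroVec_affineEquiv (c t : ℂ) (n : ℤ) (u : Fock) :
    nthProd n (virasoroVec c t) (affineEquiv 1 c (one_mul 1) u) =
      affineEquiv 1 c (one_mul 1) (nthProd n (virasoroVec 0 t) u) := by
  rw [isAutomorphism_affineEquiv (one_mul 1) n]
  conv_rhs => rw [affineEquiv_apply 1 c (one_mul 1) (virasoroVec 0 t), affineHom_virasoroVec,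
    add_zero]

/-- The representation of `sl₂(ℂ)` on the Fock space given by a conformal vector. -/
theorem exists_isSlTwoAction (c t : ℂ) : ∃ ρ : SlTwo →ₗ⁅ℂ⁆ Module.End ℂ Fock,
    IsSlTwoAction (virasoroVec c t) ρ := by
  have key : ∀ (m n : ℤ) (D D' : Module.End ℂ Fock),
      (∀ u, nthProd m (virasoroVec 0 t) (nthProd n (virasoroVec 0 t) u) -
        nthProd n (virasoroVec 0 t) (nthProd m (virasoroVec 0 t) u) = D u) →
      (∀ u, D' (affineEquiv 1 c (one_mul 1) u) = affineEquiv 1 c (one_mul 1) (D u)) →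
      ∀ u, nthProd m (virasoroVec c t) (nthProd n (virasoroVec c t) u) -
        nthProd n (virasoroVec c t) (nthProd m (virasoroVec c t) u) = D' u := by
    intro m n D D' h h' w
    obtain ⟨u, rfl⟩ := (affineEquiv 1 c (one_mul 1)).surjective w
    rw [h', ← h]
    simp only [nthProd_virasoroVec_affineEquiv, map_sub]
  have h20 := key 2 0 ((2 : ℂ) • nthProd 1 (virasoroVec 0 t))
    ((2 : ℂ) • nthProd 1 (virasoroVec c t))
    (fun u => DFunLike.congr_fun (lie_loweringDeriv_translationDeriv t) u) fun u => by
      rw [LinearMap.smul_apply, LinearMap.smul_apply, nthProd_virasoroVec_affineEquiv, map_smul]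
  have h10 := key 1 0 (nthProd 0 (virasoroVec 0 t)) (nthProd 0 (virasoroVec c t))
    (fun u => DFunLike.congr_fun (lie_weightDeriv_translationDeriv t) u) fun u => by
      rw [nthProd_virasoroVec_affineEquiv]
  have h12 := key 1 2 (-nthProd 2 (virasoroVec 0 t)) (-nthProd 2 (virasoroVec c t))
    (fun u => DFunLike.congr_fun (lie_weightDeriv_loweringDeriv t) u) fun u => by
      rw [LinearMap.neg_apply, LinearMap.neg_apply, nthProd_virasoroVec_affineEquiv, map_neg]
  refine ⟨slTwoHom (-nthProd 2 (virasoroVec c t)) (-((2 : ℂ) • nthProd 1 (virasoroVec c t)))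
    (nthProd 0 (virasoroVec c t)) (fun u => ?_) (fun u => ?_) (fun u => ?_), ?_, ?_, ?_⟩
  · have h := h20 u
    simp only [LinearMap.neg_apply, LinearMap.smul_apply, map_neg] at h ⊢
    rw [← h]
    abel
  · have h := h12 u
    simp only [LinearMap.neg_apply, LinearMap.smul_apply, map_neg, map_smul, neg_neg] at h ⊢
    rw [← h]
    module
  · have h := h10 u
    simp only [LinearMap.neg_apply, LinearMap.smul_apply, map_neg, map_smul] at h ⊢
    conv_rhs => rw [← h]
    module
  · change (slE.1 0 1 • _ + slE.1 0 0 • _ + slE.1 1 0 • _ : Module.End ℂ Fock) = _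
    simp [slE]
  · change (slH.1 0 1 • _ + slH.1 0 0 • _ + slH.1 1 0 • _ : Module.End ℂ Fock) = _
    simp [slH]
  · change (slF.1 0 1 • _ + slF.1 0 0 • _ + slF.1 1 0 • _ : Module.End ℂ Fock) = _
    simp [slF]

/-! ### Submodules and complements -/

/-- `W` is stable under the operators `L₋₁`, `L₀`, `L₁` given by `v`. -/
def IsStable (v : Fock) (W : Submodule ℂ Fock) : Prop :=
  ∀ n : ℕ, n ≤ 2 → ∀ w ∈ W, nthProd n v w ∈ W

theorem IsSlTwoAction.isStable_iff {v : Fock} {ρ : SlTwo →ₗ⁅ℂ⁆ Module.End ℂ Fock}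
    (h : IsSlTwoAction v ρ) (W : Submodule ℂ Fock) :
    IsStable v W ↔ ∀ x, ∀ w ∈ W, ρ x w ∈ W := by
  constructor
  · intro hW x w hw
    rw [slTwo_eq x, map_add, map_add, map_smul, map_smul, map_smul, h.map_E, h.map_H, h.map_F]
    simp only [LinearMap.add_apply, LinearMap.smul_apply, LinearMap.neg_apply]
    exact W.add_mem (W.add_mem (W.smul_mem _ (W.neg_mem (hW 2 le_rfl w hw)))
      (W.smul_mem _ (W.neg_mem (W.smul_mem _ (hW 1 (by norm_num) w hw)))))
      (W.smul_mem _ (hW 0 (by norm_num) w hw))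
  · intro hW n hn w hw
    interval_cases n
    · have := hW slF w hw
      rwa [h.map_F] at this
    · have := W.smul_mem (-(2⁻¹ : ℂ)) (hW slH w hw)
      rw [h.map_H] at this
      simpa using this
    · have := W.neg_mem (hW slE w hw)
      rw [h.map_E] at this
      simpa using this

theorem IsSlTwoAction.isCompletelyReducible_iff {v : Fock} {ρ : SlTwo →ₗ⁅ℂ⁆ Module.End ℂ Fock}
    (h : IsSlTwoAction v ρ) : IsCompletelyReducible ρ ↔
      ∀ W : Submodule ℂ Fock, IsStable v W → ∃ W', IsStable v W' ∧ IsCompl W W' := by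
  let _ : LieRingModule SlTwo Fock := LieRingModule.compLieHom Fock ρ
  have hlie : ∀ (x : SlTwo) (u : Fock), ⁅x, u⁆ = ρ x u := fun _ _ => rfl
  have hcompl : ∀ W W' : LieSubmodule ℂ SlTwo Fock,
      IsCompl W W' ↔ IsCompl (W : Submodule ℂ Fock) (W' : Submodule ℂ Fock) := fun W W' =>
    LieSubmodule.isCompl_toSubmodule.symm
  change ComplementedLattice (LieSubmodule ℂ SlTwo Fock) ↔ _
  constructor
  · rintro ⟨hc⟩ W hW
    obtain ⟨W', hW'⟩ := hc { W with lie_mem := fun {x u} hu => (h.isStable_iff W).mp hW x u hu }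
    exact ⟨W', (h.isStable_iff _).mpr fun x w hw => W'.lie_mem hw, (hcompl _ _).mp hW'⟩
  · refine fun hc => ⟨fun W => ?_⟩
    obtain ⟨W', hW', hWW'⟩ := hc W ((h.isStable_iff _).mpr fun x w hw => W.lie_mem hw)
    exact ⟨{ W' with lie_mem := fun {x u} hu => (h.isStable_iff W').mp hW' x u hu },
      (hcompl _ _).mpr hWW'⟩

theorem exists_isCompl_of_virasoroVec_zero {t : ℂ} (c : ℂ)
    (h : ∀ W : Submodule ℂ Fock, IsStable (virasoroVec 0 t) W →
      ∃ W', IsStable (virasoroVec 0 t) W' ∧ IsCompl W W')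
    (W : Submodule ℂ Fock) (hW : IsStable (virasoroVec c t) W) :
    ∃ W', IsStable (virasoroVec c t) W' ∧ IsCompl W W' := by
  set τ := affineEquiv 1 c (one_mul 1) with hτ
  obtain ⟨W', hW', hc⟩ := h (W.comap τ.toLinearMap) fun n hn w hw => by
    have := hW n hn _ hw
    rwa [Submodule.mem_comap, LinearEquiv.coe_coe, hτ, ← nthProd_virasoroVec_affineEquiv]
  refine ⟨W'.map τ.toLinearMap, ?_, ?_⟩
  · rintro n hn _ ⟨w, hw, rfl⟩
    refine ⟨_, hW' n hn w hw, ?_⟩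
    rw [LinearEquiv.coe_coe, hτ, ← nthProd_virasoroVec_affineEquiv]
  · have := (Submodule.orderIsoMapComap τ).isCompl hc
    rwa [Submodule.orderIsoMapComap_apply, Submodule.orderIsoMapComap_apply,
      Submodule.map_comap_eq_of_surjective τ.surjective] at this

/-! ### The case t ≠ 0 -/

theorem nthProd_virasoroVec_one (c t : ℂ) {n : ℕ} (hn : n ≤ 2) :
    nthProd n (virasoroVec c t) 1 = 0 := by
  have h := nthProd_virasoroVec_affineEquiv c t n 1
  rwa [(isAutomorphism_affineEquiv (one_mul 1)).map_one, ← virasoroDeriv_apply t hn,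
    Derivation.map_one_eq_zero, map_zero] at h

theorem affineEquiv_one_X_one (c : ℂ) :
    affineEquiv 1 c (one_mul 1) (X 1) = X 1 + c • (1 : Fock) := by
  rw [affineEquiv_apply, affineHom_X, one_smul, if_pos rfl, smul_eq_C_mul, mul_one]

/-- A complement of the constants contains x₁ plus some constant. Applying L₀ shows that it contains
x₁ + c, and then L₁ sends this to -2t, a nonzero constant. -/
theorem not_forall_exists_isCompl {c t : ℂ} (ht : t ≠ 0) :
    ¬ ∀ W : Submodule ℂ Fock, IsStable (virasoroVec c t) W →
      ∃ W', IsStable (virasoroVec c t) W' ∧ IsCompl W W' := by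
  intro h
  obtain ⟨W', hW', hc⟩ := h (ℂ ∙ (1 : Fock)) fun n hn w hw => by
    obtain ⟨a, rfl⟩ := Submodule.mem_span_singleton.mp hw
    rw [map_smul, nthProd_virasoroVec_one c t hn, smul_zero]
    exact Submodule.zero_mem _
  obtain ⟨_, hy, w, hw, hx⟩ := Submodule.mem_sup.mp (hc.sup_eq_top ▸ Submodule.mem_top (x := X 1))
  obtain ⟨a, rfl⟩ := Submodule.mem_span_singleton.mp hy
  have hw' : w = affineEquiv 1 c (one_mul 1) (X 1) - (a + c) • (1 : Fock) := by
    rw [affineEquiv_one_X_one, ← hx]; module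
  have h1 : affineEquiv 1 c (one_mul 1) (X 1) ∈ W' := by
    have h := hW' 1 (by norm_num) w hw
    rw [hw', map_sub, map_smul, nthProd_virasoroVec_one c t (by norm_num), smul_zero, sub_zero,
      nthProd_virasoroVec_affineEquiv, ← virasoroDeriv_apply t (by norm_num), weightDeriv_X] at h
    simpa using h
  have h2 : (-(2 * t)) • (1 : Fock) ∈ W' := by
    have h := hW' 2 le_rfl _ h1
    rwa [nthProd_virasoroVec_affineEquiv, ← virasoroDeriv_apply t le_rfl, loweringDeriv_X_one,
      ← mul_one (C _), ← smul_eq_C_mul, map_smul,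
      (isAutomorphism_affineEquiv (one_mul 1)).map_one] at h
  have h3 := Submodule.disjoint_def.mp hc.disjoint _
    (Submodule.smul_mem _ _ (Submodule.mem_span_singleton_self _)) h2
  rcases smul_eq_zero.mp h3 with h | h
  · exact ht (by simpa using h)
  · exact one_ne_zero h

/-- The weight of a monomial, where `xᵢ` has weight `i`. -/
noncomputable def monomialWeight : (ℕ+ →₀ ℕ) →+ ℕ := Finsupp.weight fun i : ℕ+ => (i : ℕ)

theorem coeff_weightDeriv (t : ℂ) (d : ℕ+ →₀ ℕ) (u : Fock) :
    coeff d (nthProd 1 (virasoroVec 0 t) u) = monomialWeight d * coeff d u := by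
  have key : ∀ (e : ℕ+ →₀ ℕ) (c : ℂ), virasoroDeriv t 1 (by norm_num) (monomial e c) =
      (monomialWeight e : ℂ) • monomial e c := fun e c => by
    induction e using Finsupp.induction_linear generalizing c with
    | zero =>
      change virasoroDeriv t 1 _ (C c) = _
      rw [derivation_C, map_zero, Nat.cast_zero, zero_smul]
    | add e e' he he' =>
      have h : monomial (e + e') c = monomial e c * monomial e' (1 : ℂ) := by
        rw [monomial_mul, mul_one]
      rw [h, Derivation.leibniz, he, he', map_add]
      simp only [smul_eq_mul, smul_eq_C_mul]
      push_cast
      rw [C_add]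
      ring
    | single i k =>
      rw [← C_mul_X_pow_eq_monomial, ← smul_eq_C_mul, Derivation.map_smul, Derivation.leibniz_pow,
        weightDeriv_X,
        monomialWeight, Finsupp.weight_single]
      rcases Nat.eq_zero_or_pos k with rfl | hk
      · simp
      · obtain ⟨k, rfl⟩ := Nat.exists_eq_succ_of_ne_zero hk.ne'
        simp only [smul_eq_mul, smul_eq_C_mul, Nat.succ_sub_one, nsmul_eq_mul, pow_succ]
        push_cast
        simp only [C_mul, C_add, map_natCast, C_1]
        ring
  change coeff d (virasoroDeriv t 1 (by norm_num) u) = _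
  induction u using MvPolynomial.induction_on' with
  | monomial e c =>
    rw [key, coeff_smul, coeff_monomial]
    split_ifs with h
    · rw [h, smul_eq_mul]
    · simp
  | add p q hp hq => rw [map_add, coeff_add, coeff_add, hp, hq, mul_add]

theorem monomialWeight_eq_one {d : ℕ+ →₀ ℕ} (h : monomialWeight d = 1) :
    d = Finsupp.single 1 1 := by
  have h0 : d ≠ 0 := by rintro rfl; simp at h
  obtain ⟨i, hi⟩ := Finsupp.ne_iff.mp h0
  have hi1 : Finsupp.single i 1 ≤ d :=
    Finsupp.single_le_iff.mpr (Nat.one_le_iff_ne_zero.mpr hi)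
  obtain ⟨e, rfl⟩ := exists_add_of_le hi1
  rw [map_add] at h
  have hs : monomialWeight (Finsupp.single i 1) = i := by
    rw [monomialWeight, Finsupp.weight_single, one_smul]
  have he : monomialWeight e = 0 := by have := i.pos; omega
  have hi' : i = 1 := PNat.coe_injective (by rw [PNat.one_coe]; have := i.pos; omega)
  have : e = 0 := by
    by_contra hne
    obtain ⟨j, hj⟩ := Finsupp.ne_iff.mp hne
    obtain ⟨e', rfl⟩ := exists_add_of_le (Finsupp.single_le_iff.mpr (Nat.one_le_iff_ne_zero.mpr hj))
    rw [map_add, monomialWeight, Finsupp.weight_single, one_smul] at he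
    have := j.pos
    omega
  rw [this, hi', add_zero]

/-- Fixing v means commuting with all its modes, so L₀ and L₁ determine σ(x₁), and x₁ generates the
vertex algebra. -/
theorem eq_refl_of_map_virasoroVec_zero {t : ℂ} (ht : t ≠ 0) {σ : Fock ≃ₗ[ℂ] Fock}
    (hσ : IsAutomorphism σ) (h : σ (virasoroVec 0 t) = virasoroVec 0 t) :
    σ = LinearEquiv.refl ℂ Fock := by
  have hcomm : ∀ n u, σ (nthProd n (virasoroVec 0 t) u) = nthProd n (virasoroVec 0 t) (σ u) :=
    fun n u => by rw [hσ, h]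
  -- The eigenspace of L₀ for the eigenvalue 1 is spanned by x₁.
  obtain ⟨s, hs⟩ : ∃ s : ℂ, σ (X 1) = s • X 1 := by
    refine ⟨coeff (Finsupp.single 1 1) (σ (X 1)), ?_⟩
    have h1 := hcomm 1 (X 1)
    have h2 := weightDeriv_X t 1
    rw [virasoroDeriv_apply, PNat.one_coe, Nat.cast_one, Nat.cast_one, one_smul] at h2
    rw [h2] at h1
    ext d
    rw [coeff_smul, coeff_X]
    have h3 := congrArg (coeff d) h1
    rw [coeff_weightDeriv] at h3
    split_ifs with hd
    · rw [hd, smul_eq_mul, mul_one]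
    · rw [smul_zero]
      have h4 : ((monomialWeight d : ℂ) - 1) * coeff d (σ (X 1)) = 0 := by linear_combination -h3
      refine (mul_eq_zero.mp h4).resolve_left fun h5 => hd (monomialWeight_eq_one ?_).symm
      exact_mod_cast sub_eq_zero.mp h5
  -- Apply σ to L₁x₁ = -2t: the constant is fixed, while x₁ is scaled by s.
  have hs1 : s = 1 := by
    have h1 := hcomm 2 (X 1)
    have h2 := loweringDeriv_X_one t
    rw [virasoroDeriv_apply, ← mul_one (C _), ← smul_eq_C_mul] at h2
    rw [hs, map_smul] at h1
    change nthProd 2 _ _ = _ at h2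
    rw [h2, map_smul, hσ.map_one, smul_smul] at h1
    have h3 := smul_left_injective ℂ (one_ne_zero (α := Fock)) h1
    have h4 : t * (s - 1) = 0 := by linear_combination h3 / 2
    exact sub_eq_zero.mp ((mul_eq_zero.mp h4).resolve_left ht)
  rw [hs1, one_smul] at hs
  -- Multiplication by xᵢ is the mode of index -i of x₁, which σ fixes.
  have hX : ∀ (i : ℕ+) (u : Fock), σ (X i * u) = X i * σ u := fun i u => by
    have := hσ (-(i : ℤ)) (X 1) u
    rwa [hs, nthProd_X_one, alpha_neg, alpha_neg] at this
  refine LinearEquiv.ext fun u => ?_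
  rw [LinearEquiv.refl_apply]
  induction u using MvPolynomial.induction_on with
  | C a => rw [← mul_one (C a), ← smul_eq_C_mul, map_smul, hσ.map_one]
  | add p q hp hq => rw [map_add, hp, hq]
  | mul_X p i hp => rw [mul_comm, hX, hp]

theorem eq_refl_of_map_virasoroVec {c t : ℂ} (ht : t ≠ 0) {σ : Fock ≃ₗ[ℂ] Fock}
    (hσ : IsAutomorphism σ) (h : σ (virasoroVec c t) = virasoroVec c t) :
    σ = LinearEquiv.refl ℂ Fock := by
  set τ := affineEquiv 1 c (one_mul 1) with hτ
  have hτa : IsAutomorphism τ := isAutomorphism_affineEquiv (one_mul 1)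
  have hv : τ (virasoroVec 0 t) = virasoroVec c t := by
    rw [hτ, affineEquiv_apply, affineHom_virasoroVec, add_zero]
  have := eq_refl_of_map_virasoroVec_zero ht ((hτa.trans hσ).trans hτa.symm) (by
    rw [LinearEquiv.trans_apply, LinearEquiv.trans_apply, hv, h, ← hv,
      LinearEquiv.symm_apply_apply])
  refine LinearEquiv.ext fun u => ?_
  obtain ⟨w, rfl⟩ := τ.surjective u
  have h1 := DFunLike.congr_fun this w
  rw [LinearEquiv.trans_apply, LinearEquiv.trans_apply, LinearEquiv.symm_apply_eq] at h1
  exact h1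

/-! ### The case t = 0: the Hermitian form and orthogonal complements -/

/-- The squared norm `∏ᵢ dᵢ! i^dᵢ` of the monomial with exponents `d`. -/
noncomputable def monomialNorm (d : ℕ+ →₀ ℕ) : ℕ := d.prod fun i k => k.factorial * (i : ℕ) ^ k

theorem monomialNorm_pos (d : ℕ+ →₀ ℕ) : 0 < monomialNorm d :=
  Finset.prod_pos fun i _ => Nat.mul_pos (Nat.factorial_pos _) (pow_pos i.pos _)

theorem monomialNorm_single_add (i : ℕ+) (d : ℕ+ →₀ ℕ) :
    monomialNorm (Finsupp.single i 1 + d) = (i : ℕ) * (d i + 1) * monomialNorm d := by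
  have h : ∀ e : ℕ+ →₀ ℕ, (e i).factorial * (i : ℕ) ^ e i * monomialNorm (e.erase i) =
      monomialNorm e := fun e => 
    Finsupp.mul_prod_erase' e i (fun i k => k.factorial * (i : ℕ) ^ k) fun j => by simp
  rw [← h (Finsupp.single i 1 + d), ← h d, Finsupp.erase_add, Finsupp.erase_single, zero_add,
    Finsupp.add_apply, Finsupp.single_eq_same, add_comm 1, Nat.factorial_succ, pow_succ]
  ring

/-- The symmetric bilinear form on the Fock space for which `α₋ₙ` is adjoint to `αₙ`. -/
noncomputable def fockForm : Fock →ₗ[ℂ] Fock →ₗ[ℂ] ℂ :=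
  (basisMonomials ℕ+ ℂ).constr ℂ fun d => (monomialNorm d : ℂ) • lcoeff ℂ d

theorem fockForm_monomial (d : ℕ+ →₀ ℕ) (c : ℂ) (g : Fock) :
    fockForm (monomial d c) g = c * (monomialNorm d * coeff d g) := by
  have h : monomial d c = c • (basisMonomials ℕ+ ℂ d) := by
    rw [coe_basisMonomials, smul_monomial, smul_eq_mul, mul_one]
  rw [h, map_smul, fockForm, Module.Basis.constr_basis]
  rfl

theorem fockForm_eq_sum (f g : Fock) :
    fockForm f g = ∑ d ∈ f.support, coeff d f * (monomialNorm d * coeff d g) := by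
  conv_lhs => rw [f.as_sum]
  rw [map_sum, LinearMap.sum_apply]
  exact Finset.sum_congr rfl fun d _ => fockForm_monomial _ _ _

theorem fockForm_symm (f g : Fock) : fockForm f g = fockForm g f := by
  induction f using MvPolynomial.induction_on' with
  | monomial d c =>
    induction g using MvPolynomial.induction_on' with
    | monomial e r =>
      rw [fockForm_monomial, fockForm_monomial, coeff_monomial, coeff_monomial]
      rcases eq_or_ne d e with rfl | hne
      · rw [if_pos rfl, if_pos rfl]; ring
      · rw [if_neg hne, if_neg hne.symm]; ring
    | add p q hp hq => rw [map_add, map_add, LinearMap.add_apply, hp, hq]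
  | add p q hp hq => rw [map_add, map_add, LinearMap.add_apply, hp, hq]

theorem fockForm_X_mul (i : ℕ+) (f g : Fock) :
    fockForm (X i * f) g = fockForm f (alpha i g) := by
  induction f using MvPolynomial.induction_on' with
  | monomial d c =>
    rw [X, monomial_mul, one_mul, fockForm_monomial, fockForm_monomial, monomialNorm_single_add,
      alpha_coe, coeff_smul, coeff_pderiv, add_comm d, smul_eq_mul]
    push_cast
    ring
  | add p q hp hq =>
    rw [mul_add, map_add, map_add, LinearMap.add_apply, LinearMap.add_apply, hp, hq]

theorem fockForm_alpha (n : ℤ) (f g : Fock) :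
    fockForm (alpha n f) g = fockForm f (alpha (-n) g) := by
  rcases lt_trichotomy n 0 with hn | rfl | hn
  · obtain ⟨k, hk⟩ := exists_pnat_of_pos (neg_pos.mpr hn)
    obtain rfl : n = -(k : ℤ) := by omega
    rw [alpha_neg, fockForm_X_mul, neg_neg]
  · simp [alpha_zero]
  · obtain ⟨k, rfl⟩ := exists_pnat_of_pos hn
    rw [fockForm_symm, ← fockForm_X_mul, alpha_neg, fockForm_symm]

theorem nthProd_virasoroVec_zero_zero {n : ℕ} (hn : n ≤ 2) (u : Fock) :
    nthProd n (virasoroVec 0 0) u = ∑ᶠ j : ℕ, alpha (-(j : ℤ) - 1) (alpha (n + j) u) := by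
  rw [nthProd_virasoroVec_zero hn, mul_zero, neg_zero, zero_smul, add_zero]

theorem nthProd_virasoroVec_zero_zero_finite (n : ℤ) (u : Fock) :
    (Function.support fun j : ℕ => alpha (-(j : ℤ) - 1) (alpha (n + j) u)).Finite :=
  creation_support_finite alphaField alphaField n u

/-- The adjoint of α₋ⱼ₋₂ αⱼ₊₁ is α₋ⱼ₋₁ αⱼ₊₂. The term of L₋₁ with α₀ vanishes, so its sum is shifted
by one to match that of L₁. -/
theorem fockForm_nthProd_zero (f g : Fock) : fockForm (nthProd 0 (virasoroVec 0 0) f) g =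
    fockForm f (nthProd 2 (virasoroVec 0 0) g) := by
  have h0 := nthProd_virasoroVec_zero_zero (n := 0) (by norm_num) f
  have h2 := nthProd_virasoroVec_zero_zero (n := 2) le_rfl g
  rw [Nat.cast_zero] at h0
  rw [Nat.cast_ofNat] at h2
  rw [h0, h2, fockForm_symm]
  have e1 := (fockForm g).toAddMonoidHom.map_finsum (nthProd_virasoroVec_zero_zero_finite 0 f)
  have e2 := (fockForm f).toAddMonoidHom.map_finsum (nthProd_virasoroVec_zero_zero_finite 2 g)
  refine e1.trans (Eq.trans ?_ e2.symm)
  rw [← finsum_nat_add_eq 1 fun j hj => ?_]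
  · refine finsum_congr fun j => ?_
    change fockForm g _ = fockForm f _
    rw [fockForm_symm, fockForm_alpha, fockForm_alpha,
      show -(0 + ((j + 1 : ℕ) : ℤ)) = -(j : ℤ) - 1 by push_cast; ring,
      show -(-((j + 1 : ℕ) : ℤ) - 1) = 2 + (j : ℤ) by push_cast; ring]
  · obtain rfl : j = 0 := by omega
    simp [alpha_zero]

theorem fockForm_nthProd_one (f g : Fock) : fockForm (nthProd 1 (virasoroVec 0 0) f) g =
    fockForm f (nthProd 1 (virasoroVec 0 0) g) := by
  have h0 := nthProd_virasoroVec_zero_zero (n := 1) (by norm_num) f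
  have h2 := nthProd_virasoroVec_zero_zero (n := 1) (by norm_num) g
  rw [Nat.cast_one] at h0 h2
  rw [h0, h2, fockForm_symm]
  have e1 := (fockForm g).toAddMonoidHom.map_finsum (nthProd_virasoroVec_zero_zero_finite 1 f)
  have e2 := (fockForm f).toAddMonoidHom.map_finsum (nthProd_virasoroVec_zero_zero_finite 1 g)
  refine e1.trans (Eq.trans (finsum_congr fun j => ?_) e2.symm)
  change fockForm g _ = fockForm f _
  rw [fockForm_symm, fockForm_alpha, fockForm_alpha, show -(1 + (j : ℤ)) = -(j : ℤ) - 1 by ring,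
    show -(-(j : ℤ) - 1) = 1 + (j : ℤ) by ring]

/-- Complex conjugation of the coefficients. -/
noncomputable def fockConj : Fock →+* Fock := MvPolynomial.map (starRingEnd ℂ)

theorem coeff_fockConj (d : ℕ+ →₀ ℕ) (f : Fock) :
    coeff d (fockConj f) = starRingEnd ℂ (coeff d f) := coeff_map _ _ _

theorem fockConj_smul (c : ℂ) (f : Fock) : fockConj (c • f) = starRingEnd ℂ c • fockConj f := by
  ext d
  rw [coeff_fockConj, coeff_smul, coeff_smul, coeff_fockConj, smul_eq_mul, smul_eq_mul, map_mul]

theorem fockForm_fockConj (f g : Fock) :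
    fockForm (fockConj f) (fockConj g) = starRingEnd ℂ (fockForm f g) := by
  induction f using MvPolynomial.induction_on' with
  | monomial d c =>
    rw [fockConj, map_monomial, fockForm_monomial, fockForm_monomial, coeff_map, map_mul, map_mul,
      map_natCast]
  | add p q hp hq => simp only [map_add, LinearMap.add_apply, hp, hq]

theorem fockConj_alpha (n : ℤ) (f : Fock) : fockConj (alpha n f) = alpha n (fockConj f) := by
  rcases lt_trichotomy n 0 with hn | rfl | hn
  · obtain ⟨k, hk⟩ := exists_pnat_of_pos (neg_pos.mpr hn)
    obtain rfl : n = -(k : ℤ) := by omega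
    rw [alpha_neg, alpha_neg, map_mul, fockConj, map_X]
  · simp [alpha_zero]
  · obtain ⟨k, rfl⟩ := exists_pnat_of_pos hn
    rw [alpha_coe, alpha_coe, fockConj_smul, map_natCast, fockConj, pderiv_map]

theorem fockConj_nthProd {n : ℕ} (hn : n ≤ 2) (f : Fock) :
    fockConj (nthProd n (virasoroVec 0 0) f) = nthProd n (virasoroVec 0 0) (fockConj f) := by
  rw [nthProd_virasoroVec_zero_zero hn, nthProd_virasoroVec_zero_zero hn]
  refine (fockConj.toAddMonoidHom.map_finsum (nthProd_virasoroVec_zero_zero_finite n f)).trans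
    (finsum_congr fun j => ?_)
  change fockConj _ = _
  rw [fockConj_alpha, fockConj_alpha]

/-- The positive definite Hermitian form on the Fock space. -/
noncomputable abbrev fockCore : InnerProductSpace.Core ℂ Fock where
  inner f g := fockForm (fockConj f) g
  conj_inner_symm f g := by
    rw [← fockForm_fockConj, fockForm_symm]
    congr 2
    ext d
    rw [coeff_fockConj, coeff_fockConj, starRingEnd_self_apply]
  re_inner_nonneg f := by
    rw [fockForm_symm, fockForm_eq_sum, map_sum]
    refine Finset.sum_nonneg fun d _ => ?_
    rw [coeff_fockConj, mul_left_comm, Complex.mul_conj]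
    exact_mod_cast mul_nonneg (Nat.cast_nonneg _) (Complex.normSq_nonneg _)
  add_left f g h := by rw [map_add, map_add, LinearMap.add_apply]
  smul_left f g c := by rw [fockConj_smul, map_smul, LinearMap.smul_apply, smul_eq_mul]
  definite f h := by
    rw [fockForm_symm, fockForm_eq_sum] at h
    have e : ∀ d, coeff d f * (monomialNorm d * coeff d (fockConj f)) =
        ((monomialNorm d * Complex.normSq (coeff d f) : ℝ) : ℂ) := fun d => by
      rw [coeff_fockConj, mul_left_comm, Complex.mul_conj]; push_cast; rfl
    simp only [e] at h
    rw [← Complex.ofReal_sum, Complex.ofReal_eq_zero,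
      Finset.sum_eq_zero_iff_of_nonneg fun d _ =>
        mul_nonneg (Nat.cast_nonneg _) (Complex.normSq_nonneg _)] at h
    ext d
    rw [coeff_zero]
    by_contra hd
    have h1 := h d (mem_support_iff.mpr hd)
    rcases mul_eq_zero.mp h1 with h2 | h2
    · exact (monomialNorm_pos d).ne' (by exact_mod_cast h2)
    · exact hd (Complex.normSq_eq_zero.mp h2)

theorem finite_monomialWeight_eq (n : ℕ) : {d : ℕ+ →₀ ℕ | monomialWeight d = n}.Finite := by
  have hle : ∀ (d : ℕ+ →₀ ℕ) (i : ℕ+), d i * (i : ℕ) ≤ monomialWeight d := fun d i => by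
    have h : Finsupp.single i (d i) ≤ d := Finsupp.single_le_iff.mpr le_rfl
    obtain ⟨e, he⟩ := exists_add_of_le h
    conv_rhs => rw [he]
    rw [map_add, monomialWeight, Finsupp.weight_single, smul_eq_mul]
    exact Nat.le_add_right _ _
  refine (Finset.finsupp (Finset.Icc 1 n.succPNat) fun _ =>
    Finset.range (n + 1)).finite_toSet.subset fun d hd => ?_
  rw [Finset.mem_coe, Finset.mem_finsupp_iff]
  refine ⟨fun i hi => Finset.mem_Icc.mpr ⟨one_le, ?_⟩, fun i _ => Finset.mem_range.mpr ?_⟩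
  · have h1 := hle d i
    rw [show monomialWeight d = n from hd] at h1
    have h2 : (i : ℕ) ≤ n :=
      (Nat.le_mul_of_pos_left _ (Nat.pos_of_ne_zero (Finsupp.mem_support_iff.mp hi))).trans h1
    rw [← PNat.coe_le_coe, Nat.succPNat_coe]
    exact h2.trans (Nat.le_succ n)
  · have h1 := hle d i
    rw [show monomialWeight d = n from hd] at h1
    exact Nat.lt_succ_of_le ((Nat.le_mul_of_pos_right _ i.pos).trans h1)

/-- The space of polynomials of weight `n`. -/
noncomputable def weightSpace (n : ℕ) : Submodule ℂ Fock :=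
  restrictSupport ℂ {d | monomialWeight d = n}

theorem mem_weightSpace {n : ℕ} {f : Fock} :
    f ∈ weightSpace n ↔ ∀ d, coeff d f ≠ 0 → monomialWeight d = n := by
  rw [weightSpace, mem_restrictSupport_iff]
  exact ⟨fun h d hd => h (mem_support_iff.mpr hd), fun h d hd => h d (mem_support_iff.mp hd)⟩

theorem finiteDimensional_weightSpace (n : ℕ) : FiniteDimensional ℂ (weightSpace n) := by
  have := (finite_monomialWeight_eq n).to_subtype
  exact Module.Basis.finiteDimensional_of_finite (basisRestrictSupport ℂ _)

theorem nthProd_one_of_mem_weightSpace {n : ℕ} {f : Fock} (hf : f ∈ weightSpace n) :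
    nthProd 1 (virasoroVec 0 0) f = (n : ℂ) • f := by
  ext d
  rw [coeff_weightDeriv, coeff_smul, smul_eq_mul]
  by_cases h : coeff d f = 0
  · rw [h, mul_zero, mul_zero]
  · rw [mem_weightSpace.mp hf d h]

/-- The orthogonal complement is stable because the adjoints are again among L₋₁, L₀, L₁. The Fock
space is not complete, so W ⊔ Wᗮ = ⊤ is obtained weight by weight, projecting inside the
finite-dimensional weight spaces. -/
theorem exists_isCompl_of_isStable (W : Submodule ℂ Fock) (hW : IsStable (virasoroVec 0 0) W) :
    ∃ W', IsStable (virasoroVec 0 0) W' ∧ IsCompl W W' := by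
  let core := fockCore
  let _ : NormedAddCommGroup Fock := core.toNormedAddCommGroup
  let _ : InnerProductSpace ℂ Fock := InnerProductSpace.ofCore core.toCore
  have hinner : ∀ f g : Fock, inner ℂ f g = fockForm (fockConj f) g := fun _ _ => rfl
  have hadj : ∀ (n : ℕ), n ≤ 2 → ∀ f g : Fock,
      inner ℂ f (nthProd n (virasoroVec 0 0) g) =
        inner ℂ (nthProd ((2 - n : ℕ) : ℤ) (virasoroVec 0 0) f) g := fun n hn f g => by
    rw [hinner, hinner, fockConj_nthProd (by omega)]
    interval_cases n
    · rw [fockForm_symm]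
      exact (fockForm_nthProd_zero _ _).trans (fockForm_symm _ _)
    · exact (fockForm_nthProd_one _ _).symm
    · exact (fockForm_nthProd_zero _ _).symm
  refine ⟨Wᗮ, fun n hn g hg w hw => ?_, isCompl_iff.mpr ⟨W.orthogonal_disjoint, ?_⟩⟩
  · rw [hadj n hn]
    exact hg _ (hW _ (by omega) w hw)
  rw [codisjoint_iff, eq_top_iff]
  have hmono : ∀ (d : ℕ+ →₀ ℕ) (c : ℂ), monomial d c ∈ W ⊔ Wᗮ := by
    intro d c
    set n := monomialWeight d with hn
    have hu : monomial d c ∈ weightSpace n := mem_weightSpace.mpr fun e he => by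
      rw [coeff_monomial] at he
      rw [hn]
      exact congrArg _ (of_not_not fun h => he (if_neg fun h' => h h'.symm))
    have := finiteDimensional_weightSpace n
    have : FiniteDimensional ℂ (W ⊓ weightSpace n : Submodule ℂ Fock) :=
      Submodule.finiteDimensional_of_le inf_le_right
    -- The remainder q has weight n and is orthogonal to the weight-n part of W; it remains to see
    -- that it is orthogonal to all of W.
    obtain ⟨p, hp, q, hq, h⟩ := (W ⊓ weightSpace n).exists_add_mem_mem_orthogonal (monomial d c)
    have hqn : q ∈ weightSpace n := by
      have : q = monomial d c - p := by rw [h]; abel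
      rw [this]
      exact Submodule.sub_mem _ hu hp.2
    -- Induction on the set of further weights occurring in w: L₀ - k removes weight k, keeps w in
    -- W, and multiplies its inner product with q by n - k ≠ 0.
    have key : ∀ (S : Finset ℕ), n ∉ S → ∀ w ∈ W,
        (∀ e, coeff e w ≠ 0 → monomialWeight e ∈ insert n S) → inner ℂ w q = 0 := by
      intro S
      induction S using Finset.induction_on with
      | empty =>
        intro _ w hw he
        refine hq w ⟨hw, mem_weightSpace.mpr fun e h => ?_⟩
        simpa using he e h
      | insert k S _ ih =>
        intro hnS w hw he
        rw [Finset.mem_insert, not_or] at hnS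
        have h1 := ih hnS.2 (nthProd 1 (virasoroVec 0 0) w - (k : ℂ) • w)
          (W.sub_mem (hW 1 (by norm_num) w hw) (W.smul_mem _ hw)) fun e hne => by
            rw [coeff_sub, coeff_weightDeriv, coeff_smul, smul_eq_mul, ← sub_mul] at hne
            have h2 := he e (right_ne_zero_of_mul hne)
            have h3 : monomialWeight e ≠ k := fun h =>
              left_ne_zero_of_mul hne (by rw [h, sub_self])
            simp only [Finset.mem_insert] at h2 ⊢
            tauto
        have h2 := hadj 1 (by norm_num) w q
        change inner ℂ w (nthProd 1 _ q) = inner ℂ (nthProd 1 _ w) q at h2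
        rw [inner_sub_left, ← h2, nthProd_one_of_mem_weightSpace hqn, inner_smul_right,
          inner_smul_left, map_natCast, ← sub_mul] at h1
        refine (mul_eq_zero.mp h1).resolve_left fun h3 => hnS.1 ?_
        exact_mod_cast sub_eq_zero.mp h3
    have hqW : q ∈ Wᗮ := fun w hw => by
      refine key ((w.support.image monomialWeight).erase n) (Finset.notMem_erase _ _) w hw
        fun e he => ?_
      rw [Finset.mem_insert, Finset.mem_erase]
      by_cases hen : monomialWeight e = n
      · exact Or.inl hen
      · exact Or.inr ⟨hen, Finset.mem_image_of_mem _ (mem_support_iff.mpr he)⟩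
    rw [h]
    exact Submodule.add_mem_sup hp.1 hqW
  intro f _
  rw [f.as_sum]
  exact Submodule.sum_mem _ fun d _ => hmono d _

end FreeBoson

theorem mainTheorem8 (v : FreeBoson.Fock) (hv : FreeBoson.IsConformalVector v) :
    ∃ ρ : FreeBoson.SlTwo →ₗ⁅ℂ⁆ Module.End ℂ FreeBoson.Fock,
      FreeBoson.IsSlTwoAction v ρ ∧
        (FreeBoson.IsCompletelyReducible ρ ↔
          ∃ σ : FreeBoson.Fock ≃ₗ[ℂ] FreeBoson.Fock,
            FreeBoson.IsAutomorphism σ ∧ σ ≠ LinearEquiv.refl ℂ FreeBoson.Fock ∧ σ v = v) := by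
  obtain ⟨k, hk⟩ := hv.isVirasoro
  obtain ⟨c, t, rfl⟩ := hk.exists_eq
  obtain ⟨ρ, hρ⟩ := FreeBoson.exists_isSlTwoAction c t
  refine ⟨ρ, hρ, hρ.isCompletelyReducible_iff.trans ?_⟩
  rcases eq_or_ne t 0 with rfl | ht
  · refine iff_of_true (FreeBoson.exists_isCompl_of_virasoroVec_zero c
      FreeBoson.exists_isCompl_of_isStable)
      ⟨FreeBoson.affineEquiv (-1) (-(2 * c)) (by norm_num),
        FreeBoson.isAutomorphism_affineEquiv _, fun h => ?_,
        FreeBoson.affineHom_neg_virasoroVec c⟩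
    -- The reflection is not the identity since it sends x₂ to -x₂.
    have h1 := DFunLike.congr_fun h (MvPolynomial.X 2)
    rw [FreeBoson.affineEquiv_apply, FreeBoson.affineHom_X, if_neg (by decide), add_zero,
      LinearEquiv.refl_apply] at h1
    have h2 := congrArg (MvPolynomial.coeff (Finsupp.single 2 1)) h1
    rw [MvPolynomial.coeff_smul, MvPolynomial.coeff_X, if_pos rfl] at h2
    norm_num at h2
  · exact iff_of_false (FreeBoson.not_forall_exists_isCompl ht) fun ⟨σ, hσ, hne, h⟩ =>
      hne (FreeBoson.eq_refl_of_map_virasoroVec ht hσ h)
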